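/- Let $n\ge 0$ and let $\lambda$ be a partition of $2n$. The type-$B$ $0$-Hecke algebra $H_n^B(0)$ is the unital $\mathbb C$-algebra generated by $\pi_0,\dots,\pi_{n-1}$ subject to $\pi_i^2=-\pi_i$ for all $i$; $\pi_i\pi_j=\pi_j\pi_i$ if $|i-j|\ge 2$; $\pi_i\pi_{i+1}\pi_i=\pi_{i+1}\pi_i\pi_{i+1}$ for $1\le i\le n-2$; and $\pi_0\pi_1\pi_0\pi_1=\pi_1\pi_0\pi_1\pi_0$ (if $n\ge 2$). For $I\subseteq\{0,\dots,n-1\}$, let $\mathcal S_I^B$ be the one-dimensional $H_n^B(0)$-module on which $\pi_j$ acts as $-1$ if $j\in I$ and as $0$ if $j\notin I$. Let $\mathcal G_0(H_n^B(0))$ be the Grothendieck group of finitely generated $H_n^B(0)$-modules (generated by the classes $[M]$, with $[A]-[B]+[C]=0$ for every short exact sequence $0\to A\to B\to C\to 0$). Let $\mathrm{QSym}^B$ be the space of type-$B$ quasisymmetric functions: the power series over $\mathbb C$ in $x_0,x_1,x_2,\dots$ of bounded degree in which, for all $k\ge0$, $a_0\ge 0$ and $a_1,\dots,a_k\ge 1$,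 the coefficients of $x_0^{a_0}x_{i_1}^{a_1}\cdots x_{i_k}^{a_k}$ and $x_0^{a_0}x_{j_1}^{a_1}\cdots x_{j_k}^{a_k}$ agree whenever $0<i_1<\dots<i_k$ and $0<j_1<\dots<j_k$. For $I\subseteq\{0,\dots,n-1\}$ put \[F_I^B=\sum_{\substack{0=i_0\le i_1\le\cdots\le i_n\\ j\in I\Rightarrow i_j<i_{j+1}}}x_{i_1}x_{i_2}\cdots x_{i_n}\in\mathrm{QSym}^B .\] A type-$B$ quasisymmetric characteristic is a group homomorphism $\mathrm{ch}^B:\mathcal G_0(H_n^B(0))\to\mathrm{QSym}^B$ with $\mathrm{ch}^B([\mathcal S_I^B])=F_I^B$ for all $I\subseteq\{0,\dots,n-1\}$. A standard domino tableau of shape $\lambda$ is a tiling of the Young diagram of $\lambda$ (English notation) by $1\times2$ and $2\times1$ dominoes together with a bijective filling of the dominoes with $1,\dots,n$ whose entries increase from left to right along rows and from top to bottom along columns; $\mathsf{SDT}(\lambda)$ is the set of these, and $\mathrm{dom}_i(T)$ is the domino of $T$ with entry $i$. The descent set $\mathrm{Des}(T)\subseteq\{0,\dots,n-1\}$ contains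 $0$ iff $n\ge1$ and $\mathrm{dom}_1(T)$ is vertical, and contains $i$ with $1\le i\le n-1$ iff $\mathrm{dom}_{i+1}(T)$ is strictly lower than $\mathrm{dom}_i(T)$ (every cell of the former is in a strictly lower row than every cell of the latter). For $1\le i\le n-1$, $s_i(T)$ is the filling obtained by exchanging the entries $i$ and $i+1$. If $\mathrm{dom}_1(T)$ and $\mathrm{dom}_2(T)$ tile the northwest-most $2\times2$ square, $s_0(T)$ is obtained by switching the orientation of both, with $1$ placed left of $2$ if $1$ was above $2$ in $T$, and $1$ placed above $2$ if $1$ was left of $2$; otherwise $s_0(T)$ is undefined and is regarded as not belonging to $\mathsf{SDT}(\lambda)$. On the complex vector space $\mathbb C\,\mathsf{SDT}(\lambda)$ with basis $\mathsf{SDT}(\lambda)$ define linear operators, for $0\le i\le n-1$, \[\pi_i(T)=\begin{cases}-T & i\in\mathrm{Des}(T),\\ 0 & i\notin\mathrm{Des}(T),\ s_i(T)\notin\mathsf{SDT}(\lambda),\\ s_i(T) & i\notin\mathrm{Des}(T),\ s_i(T)\in\mathsf{SDT}(\lambda).\end{cases}\] The Mayorova--Vassilieva domino function is $G_\lambda=\sum_{T\in\mathsf{SDT}(\lambda)}F^B_{\mathrm{Des}(T)}$.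 Theorem. A type-$B$ quasisymmetric characteristic $\mathrm{ch}^B$ exists; the operators $\pi_0,\dots,\pi_{n-1}$ define an action of $H_n^B(0)$ on $\mathbb C\,\mathsf{SDT}(\lambda)$; and, for this module and every type-$B$ quasisymmetric characteristic $\mathrm{ch}^B$, \[\mathrm{ch}^B\bigl([\mathbb C\,\mathsf{SDT}(\lambda)]\bigr)=G_\lambda .\] -/

import Mathlib

namespace DominoHecke

/-! ### The type-`B` 0-Hecke algebra -/

/-- Defining relations of the type-`B` 0-Hecke algebra on generators `π₀, …, π_{n-1}`. -/
inductive HeckeRel (n : ℕ) : FreeAlgebra ℂ (Fin n) → FreeAlgebra ℂ (Fin n) → Prop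
  | sq (i : Fin n) :
      HeckeRel n (FreeAlgebra.ι ℂ i * FreeAlgebra.ι ℂ i) (-FreeAlgebra.ι ℂ i)
  | comm (i j : Fin n) (h : i.val + 2 ≤ j.val) :
      HeckeRel n (FreeAlgebra.ι ℂ i * FreeAlgebra.ι ℂ j)
        (FreeAlgebra.ι ℂ j * FreeAlgebra.ι ℂ i)
  | braid (i j : Fin n) (hi : 1 ≤ i.val) (hj : j.val = i.val + 1) :
      HeckeRel n (FreeAlgebra.ι ℂ i * FreeAlgebra.ι ℂ j * FreeAlgebra.ι ℂ i)
        (FreeAlgebra.ι ℂ j * FreeAlgebra.ι ℂ i * FreeAlgebra.ι ℂ j)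
  | braidFour (i j : Fin n) (hi : i.val = 0) (hj : j.val = 1) :
      HeckeRel n
        (FreeAlgebra.ι ℂ i * FreeAlgebra.ι ℂ j * FreeAlgebra.ι ℂ i * FreeAlgebra.ι ℂ j)
        (FreeAlgebra.ι ℂ j * FreeAlgebra.ι ℂ i * FreeAlgebra.ι ℂ j * FreeAlgebra.ι ℂ i)

/-- The type-`B` 0-Hecke algebra `H_n^B(0)` over `ℂ`. -/
abbrev HeckeB (n : ℕ) : Type := RingQuot (HeckeRel n)

/-- The generator `π_i`, for `0 ≤ i ≤ n - 1`. -/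
noncomputable def gen {n : ℕ} (i : Fin n) : HeckeB n :=
  RingQuot.mkAlgHom ℂ (HeckeRel n) (FreeAlgebra.ι ℂ i)

/-- The underlying space of an algebra homomorphism `ρ : H_n^B(0) → End_ℂ(V)`,
regarded as an `H_n^B(0)`-module with `a • v = ρ a v`. -/
def RepModule {n : ℕ} {V : Type} [AddCommGroup V] [Module ℂ V]
    (_ρ : HeckeB n →ₐ[ℂ] Module.End ℂ V) : Type := V

section RepModule

variable {n : ℕ} {V : Type} [AddCommGroup V] [Module ℂ V]
  (ρ : HeckeB n →ₐ[ℂ] Module.End ℂ V)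

instance : AddCommGroup (RepModule ρ) := inferInstanceAs (AddCommGroup V)

instance : Module ℂ (RepModule ρ) := inferInstanceAs (Module ℂ V)

noncomputable instance : Module (HeckeB n) (RepModule ρ) :=
  Module.compHom V ρ.toRingHom

instance : IsScalarTower ℂ (HeckeB n) (RepModule ρ) where
  smul_assoc c a v := by
    change ρ (c • a) v = c • (ρ a v)
    rw [map_smul]
    rfl

instance [Module.Finite ℂ V] : Module.Finite (HeckeB n) (RepModule ρ) :=
  haveI : Module.Finite ℂ (RepModule ρ) := inferInstanceAs (Module.Finite ℂ V)
  Module.Finite.of_restrictScalars_finite ℂ (HeckeB n) (RepModule ρ)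

end RepModule

/-- The character of `H_n^B(0)` sending `π_j` to `-1` if `j ∈ I` and to `0` otherwise. -/
noncomputable def simpleChar {n : ℕ} (I : Finset (Fin n)) : HeckeB n →ₐ[ℂ] ℂ :=
  RingQuot.liftAlgHom ℂ
    ⟨FreeAlgebra.lift ℂ (fun j : Fin n => if j ∈ I then (-1 : ℂ) else 0), by
      intro x y h
      cases h <;> simp only [map_mul, map_neg, FreeAlgebra.lift_ι_apply] <;>
        split_ifs <;> norm_num⟩

/-- The one-dimensional simple module `S_I^B`, with underlying space `ℂ`. -/
abbrev SimpleB {n : ℕ} (I : Finset (Fin n)) : Type :=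
  RepModule ((Algebra.ofId ℂ (Module.End ℂ ℂ)).comp (simpleChar I))

/-! ### The Grothendieck group of finitely generated modules -/

/-- A finitely generated `H_n^B(0)`-module. -/
structure FGMod (n : ℕ) : Type 1 where
  carrier : Type
  [addCommGroup : AddCommGroup carrier]
  [module : Module (HeckeB n) carrier]
  [finite : Module.Finite (HeckeB n) carrier]

attribute [instance] FGMod.addCommGroup FGMod.module FGMod.finite

/-- The elements `[A] - [B] + [C]` for short exact sequences `0 → A → B → C → 0`.
(The sequences with `A = B = C = 0` and with `C = 0` identify isomorphic modules.) -/
def exactRelations (n : ℕ) : Set (FreeAbelianGroup (FGMod n)) :=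
  {x | ∃ (A B C : FGMod n)
      (f : A.carrier →ₗ[HeckeB n] B.carrier) (g : B.carrier →ₗ[HeckeB n] C.carrier),
      Function.Injective f ∧ Function.Exact f g ∧ Function.Surjective g ∧
      x = FreeAbelianGroup.of A - FreeAbelianGroup.of B + FreeAbelianGroup.of C}

/-- The Grothendieck group `𝒢₀(H_n^B(0))`. -/
abbrev G0 (n : ℕ) : Type 1 :=
  FreeAbelianGroup (FGMod n) ⧸ AddSubgroup.closure (exactRelations n)

/-- The class `[M]` of a finitely generated module in the Grothendieck group. -/
def G0.cls (n : ℕ) (M : Type) [AddCommGroup M] [Module (HeckeB n) M]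
    [Module.Finite (HeckeB n) M] : G0 n :=
  QuotientAddGroup.mk (FreeAbelianGroup.of (FGMod.mk M))

/-! ### Type-`B` quasisymmetric functions -/

/-- The space `QSym^B` of type-`B` quasisymmetric functions in `x₀, x₁, x₂, …`: power series
of bounded degree in which two monomials have equal coefficients whenever one arises from the
other by a strictly increasing relabelling of the variables that fixes `x₀`. -/
def QSymB : Submodule ℂ (MvPowerSeries ℕ ℂ) where
  carrier := {f | (∃ d : ℕ, ∀ m : ℕ →₀ ℕ, MvPowerSeries.coeff m f ≠ 0 → m.degree ≤ d) ∧
    ∀ φ : ℕ → ℕ, StrictMono φ → φ 0 = 0 → ∀ m : ℕ →₀ ℕ,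
      MvPowerSeries.coeff (m.mapDomain φ) f = MvPowerSeries.coeff m f}
  zero_mem' := by simp
  add_mem' := by
    rintro f g ⟨⟨d, hd⟩, hf⟩ ⟨⟨e, he⟩, hg⟩
    refine ⟨⟨max d e, fun m hm => ?_⟩, fun φ h1 h2 m => ?_⟩
    · by_cases h : MvPowerSeries.coeff m f = 0
      · refine le_max_of_le_right (he m fun h' => hm ?_)
        rw [map_add, h, h', add_zero]
      · exact le_max_of_le_left (hd m h)
    · rw [map_add, map_add, hf φ h1 h2 m, hg φ h1 h2 m]
  smul_mem' := by
    rintro c f ⟨⟨d, hd⟩, hf⟩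
    refine ⟨⟨d, fun m hm => hd m fun h => hm ?_⟩, fun φ h1 h2 m => ?_⟩
    · rw [map_smul, h, smul_zero]
    · rw [map_smul, map_smul, hf φ h1 h2 m]

/-- The type-`B` fundamental quasisymmetric function
`F_I^B = ∑ x_{i₁} ⋯ x_{i_n}` over `0 = i₀ ≤ i₁ ≤ ⋯ ≤ i_n` with `i_j < i_{j+1}` for `j ∈ I`.
The coefficient of a monomial counts the sequences that produce it. -/
noncomputable def FB {n : ℕ} (I : Finset (Fin n)) : MvPowerSeries ℕ ℂ :=
  fun m => (Nat.card {i : Fin (n + 1) → ℕ // i 0 = 0 ∧ Monotone i ∧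
    (∀ j ∈ I, i j.castSucc < i j.succ) ∧
    ∑ k : Fin n, Finsupp.single (i k.succ) 1 = m} : ℂ)

/-- `ch` has the defining property of the type-`B` quasisymmetric characteristic: it is a
homomorphism on the Grothendieck group with `ch [S_I^B] = F_I^B` for all
`I ⊆ {0, …, n - 1}`. -/
def IsCharB {n : ℕ} (ch : G0 n →+ QSymB) : Prop :=
  ∀ I : Finset (Fin n), (ch (G0.cls n (SimpleB I)) : MvPowerSeries ℕ ℂ) = FB I

/-! ### Standard domino tableaux

Cells are pairs (row, column) of natural numbers; rows are numbered from the top and columns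
from the left, as in `YoungDiagram`. -/

/-- A `1 × 2` rectangle. -/
def IsHorizontal (d : Finset (ℕ × ℕ)) : Prop := ∃ r c : ℕ, d = {(r, c), (r, c + 1)}

/-- A `2 × 1` rectangle. -/
def IsVertical (d : Finset (ℕ × ℕ)) : Prop := ∃ r c : ℕ, d = {(r, c), (r + 1, c)}

/-- A standard domino tableau of shape `μ` with `n` dominoes: `dom k` is the domino with entry
`k + 1`. The dominoes tile `μ`, and entries increase along rows and down columns (weakly as one
passes from cell to cell, hence strictly from domino to domino). -/
@[ext]
structure SDT (μ : YoungDiagram) (n : ℕ) where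
  dom : Fin n → Finset (ℕ × ℕ)
  isDomino : ∀ k, IsHorizontal (dom k) ∨ IsVertical (dom k)
  disjoint : ∀ k l, k ≠ l → Disjoint (dom k) (dom l)
  cover : Finset.univ.biUnion dom = μ.cells
  row_le : ∀ k l, ∀ a ∈ dom k, ∀ b ∈ dom l, a.1 = b.1 → a.2 < b.2 → k ≤ l
  col_le : ∀ k l, ∀ a ∈ dom k, ∀ b ∈ dom l, a.2 = b.2 → a.1 < b.1 → k ≤ l

instance (μ : YoungDiagram) (n : ℕ) : Finite (SDT μ n) := by
  refine Finite.of_injective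
    (fun T : SDT μ n => fun k : Fin n => (⟨T.dom k, ?_⟩ : {d // d ∈ μ.cells.powerset})) ?_
  · rw [Finset.mem_powerset, ← T.cover]
    exact Finset.subset_biUnion_of_mem T.dom (Finset.mem_univ k)
  · intro T T' h
    ext1
    funext k
    exact congrArg Subtype.val (congrFun h k)

noncomputable instance (μ : YoungDiagram) (n : ℕ) : Fintype (SDT μ n) := Fintype.ofFinite _

variable {μ : YoungDiagram} {n : ℕ}

/-- The index below `i`; used only for `i ≠ 0`. -/
def pred (i : Fin n) : Fin n := ⟨i.val - 1, lt_of_le_of_lt (Nat.sub_le _ _) i.isLt⟩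

/-- `i` is a descent of `T` if `i = 0` and the domino with entry `1` is vertical, or `i > 0` and
the domino with entry `i + 1` lies strictly lower than the domino with entry `i`. -/
def IsDescent (T : SDT μ n) (i : Fin n) : Prop :=
  (i.val = 0 ∧ IsVertical (T.dom i)) ∨
  (0 < i.val ∧ ∀ a ∈ T.dom (pred i), ∀ b ∈ T.dom i, a.1 < b.1)

open Classical in
/-- The descent set of `T`. -/
noncomputable def Des (T : SDT μ n) : Finset (Fin n) :=
  Finset.univ.filter fun i => IsDescent T i

/-- The domino `d` reflected in the main diagonal. -/
def reflect (d : Finset (ℕ × ℕ)) : Finset (ℕ × ℕ) := d.image Prod.swap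

/-- The filling `s_i(T)` when it is defined. For `i > 0` the entries `i` and `i + 1` are
exchanged; the result need not be a standard domino tableau. For `i = 0` it is defined when the
dominoes with entries `1` and `2` tile the northwest `2 × 2` square; these two dominoes are then
reflected in the main diagonal, so that both change orientation, and `1` above `2` becomes `1`
left of `2` and vice versa. -/
def sFilling (T : SDT μ n) (i : Fin n) : Option (Fin n → Finset (ℕ × ℕ)) :=
  if i.val = 0 then
    if h : 1 < n then
      if T.dom i ∪ T.dom ⟨1, h⟩ = {(0, 0), (0, 1), (1, 0), (1, 1)} then
        some fun k => if k.val ≤ 1 then reflect (T.dom k) else T.dom k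
      else none
    else none
  else some (T.dom ∘ Equiv.swap (pred i) i)

open Classical in
/-- The value of the operator `π_i` on the basis element `T` of `ℂ SDT(μ)`. -/
noncomputable def opBasis (i : Fin n) (T : SDT μ n) : SDT μ n →₀ ℂ :=
  if i ∈ Des T then -Finsupp.single T 1
  else if h : ∃ T' : SDT μ n, sFilling T i = some T'.dom then Finsupp.single h.choose 1
  else 0

/-- The linear operator `π_i` on `ℂ SDT(μ)`. -/
noncomputable def op (μ : YoungDiagram) {n : ℕ} (i : Fin n) : Module.End ℂ (SDT μ n →₀ ℂ) :=
  Finsupp.linearCombination ℂ (opBasis i)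

/-- The domino function `G_μ`. -/
noncomputable def dominoFunction (μ : YoungDiagram) (n : ℕ) : MvPowerSeries ℕ ℂ :=
  ∑ T : SDT μ n, FB (Des T)

end DominoHecke

/-! Existence of the characteristic uses traces instead of a classification of simple modules. The
algebra is finite-dimensional over `ℂ`, by induction along `p₀, …, p_{m-1}` with three double cosets
at each stage (`HeckeSeq.initialSubalgebra_succ_le`), so every finitely generated module is
finite-dimensional. The trace of a fixed algebra element is then additive on short exact sequences.
Since `selector I` takes the value 1 on `S_I^B` and 0 on the other `S_J^B`, the map `[M] ↦ ∑ I, tr_M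
(selector I) • F_I^B` is well defined and has the required values.

For the relations among the `π_i` with `i ≥ 1`, a tableau is read as the word of its dominoes. Two
dominoes that are incomparable under "strictly above" share a row, and then their exchange is never
standard. So `π_i` is the restriction of an operator that sorts adjacent letters by a strict partial
order, and such operators satisfy the 0-Hecke relations on all words (`sortOp_braid`, `toWords_op`).
For `π₀` the geometry is rigid: the first domino covers the corner, hence `π₁` is diagonal on
tableaux and the four-term relation is immediate. The delicate relation is that `π₀` commutes with
`π₂`, where both operators involve the domino with entry 2.

The class of the module follows from triangularity. Each `π_i` sends `T` to its value on the simple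
module of `Des T`, times `T`, plus tableaux of larger `height`. Removing tableaux of least height
one at a time filters the module with these simple modules as quotients
(`IsTriangular.cls_repModule`), and any characteristic sends the resulting sum to `G_μ`. -/

namespace DominoHecke

/-! ### Finite-dimensionality of the type-`B` 0-Hecke algebra -/

/-- A sequence in a ring satisfying the relations of the type-`B` 0-Hecke generators. -/
structure HeckeSeq {R : Type*} [Ring R] (p : ℕ → R) : Prop where
  sq : ∀ i, p i * p i = -p i
  comm : ∀ i j, i + 2 ≤ j → Commute (p i) (p j)
  braid : ∀ i, 1 ≤ i → p i * p (i + 1) * p i = p (i + 1) * p i * p (i + 1)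
  braidFour : p 0 * p 1 * p 0 * p 1 = p 1 * p 0 * p 1 * p 0

/-- The palindrome `p_m ⋯ p₁ p₀ p₁ ⋯ p_m`. -/
def palindrome {R : Type*} [Ring R] (p : ℕ → R) : ℕ → R
  | 0 => p 0
  | m + 1 => p (m + 1) * palindrome p m * p (m + 1)

/-- The subalgebra generated by `p₀, …, p_{m-1}`. -/
def initialSubalgebra {R : Type*} [Ring R] [Algebra ℂ R] (p : ℕ → R) (m : ℕ) : Subalgebra ℂ R :=
  Algebra.adjoin ℂ (p '' Set.Iio m)

/-- The sum of the double cosets of `initialSubalgebra p m` in `initialSubalgebra p (m + 1)`. -/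
def doubleCosets {R : Type*} [Ring R] [Algebra ℂ R] (p : ℕ → R) (m : ℕ) : Submodule ℂ R :=
  Subalgebra.toSubmodule (initialSubalgebra p m) ⊔
    Subalgebra.toSubmodule (initialSubalgebra p m) * Submodule.span ℂ {p m} *
      Subalgebra.toSubmodule (initialSubalgebra p m) ⊔
    Subalgebra.toSubmodule (initialSubalgebra p m) * Submodule.span ℂ {palindrome p m}

section HeckeSeq

variable {R : Type*} [Ring R] {p : ℕ → R}

theorem HeckeSeq.commute_palindrome_of_le (hp : HeckeSeq p) (m j : ℕ) (h : m + 2 ≤ j) :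
    Commute (palindrome p m) (p j) := by
  induction m with
  | zero => exact hp.comm 0 j h
  | succ m ih =>
    exact ((hp.comm _ _ h).mul_left (ih (by omega))).mul_left (hp.comm _ _ h)

/-- The outer factors of the palindrome commute with `p j` except when `j` is adjacent to `m`. There
`p j` is carried across by two braid moves, or by the four-term relation when `j = 0`. -/
theorem HeckeSeq.commute_palindrome_of_lt (hp : HeckeSeq p) (m j : ℕ) (h : j < m) :
    Commute (palindrome p m) (p j) := by
  induction m with
  | zero => omega
  | succ m ih =>
    rcases Nat.lt_or_ge j m with hj | hj
    · have h1 := (hp.comm j (m + 1) (by omega)).symm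
      exact (h1.mul_left (ih hj)).mul_left h1
    · obtain rfl : j = m := by omega
      cases j with
      | zero =>
        have := hp.braidFour
        simp only [palindrome, Commute, SemiconjBy, zero_add, mul_assoc] at this ⊢
        exact this.symm
      | succ k =>
        have hb := hp.braid (k + 1) (by omega)
        have hc : palindrome p k * p (k + 2) = p (k + 2) * palindrome p k :=
          hp.commute_palindrome_of_le k (k + 2) le_rfl
        change p (k + 2) * (p (k + 1) * palindrome p k * p (k + 1)) * p (k + 2) * p (k + 1) =
          p (k + 1) * (p (k + 2) * (p (k + 1) * palindrome p k * p (k + 1)) * p (k + 2))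
        calc _ = p (k + 2) * p (k + 1) * palindrome p k *
              (p (k + 1) * p (k + 2) * p (k + 1)) := by simp only [mul_assoc]
          _ = p (k + 2) * p (k + 1) * (palindrome p k * p (k + 2)) * p (k + 1) * p (k + 2) := by
              rw [hb]; simp only [mul_assoc]
          _ = (p (k + 2) * p (k + 1) * p (k + 2)) * palindrome p k * p (k + 1) * p (k + 2) := by
              rw [hc]; simp only [mul_assoc]
          _ = _ := by rw [← hb]; simp only [mul_assoc]

variable [Algebra ℂ R]

theorem commute_initialSubalgebra {z : R} {m : ℕ} (hz : ∀ j < m, Commute z (p j)) {a : R}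
    (ha : a ∈ initialSubalgebra p m) : Commute z a := by
  induction ha using Algebra.adjoin_induction with
  | mem x hx => obtain ⟨j, hj, rfl⟩ := hx; exact hz j hj
  | algebraMap r => exact (Algebra.commutes r z).symm
  | add x y _ _ hx hy => exact hx.add_right hy
  | mul x y _ _ hx hy => exact hx.mul_right hy

theorem mem_initialSubalgebra {m j : ℕ} (h : j < m) : p j ∈ initialSubalgebra p m :=
  Algebra.subset_adjoin ⟨j, h, rfl⟩

theorem doubleCosets_le {m : ℕ} {Y : Submodule ℂ R}
    (h1 : ∀ a ∈ initialSubalgebra p m, a ∈ Y)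
    (h2 : ∀ a ∈ initialSubalgebra p m, ∀ b ∈ initialSubalgebra p m, a * p m * b ∈ Y)
    (h3 : ∀ a ∈ initialSubalgebra p m, a * palindrome p m ∈ Y) :
    doubleCosets p m ≤ Y := by
  refine sup_le (sup_le (fun a ha => h1 a ha) ?_) ?_
  · rw [mul_assoc, Submodule.mul_le]
    intro a ha y hy
    obtain ⟨b, hb, rfl⟩ := Submodule.mem_span_singleton_mul.1 hy
    rw [← mul_assoc]
    exact h2 a ha b hb
  · rw [Submodule.mul_le]
    intro a ha y hy
    obtain ⟨c, rfl⟩ := Submodule.mem_span_singleton.1 hy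
    rw [mul_smul_comm]
    exact Y.smul_mem c (h3 a ha)

theorem mem_doubleCosets {m : ℕ} {a : R} (ha : a ∈ initialSubalgebra p m) :
    a ∈ doubleCosets p m :=
  Submodule.mem_sup_left (Submodule.mem_sup_left ha)

theorem mul_gen_mul_mem_doubleCosets {m : ℕ} {a b : R} (ha : a ∈ initialSubalgebra p m)
    (hb : b ∈ initialSubalgebra p m) : a * p m * b ∈ doubleCosets p m :=
  Submodule.mem_sup_left (Submodule.mem_sup_right
    (Submodule.mul_mem_mul (Submodule.mul_mem_mul ha (Submodule.mem_span_singleton_self _)) hb))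

theorem mul_palindrome_mem_doubleCosets {m : ℕ} {a : R} (ha : a ∈ initialSubalgebra p m) :
    a * palindrome p m ∈ doubleCosets p m :=
  Submodule.mem_sup_right (Submodule.mul_mem_mul ha (Submodule.mem_span_singleton_self _))

theorem mul_mem_doubleCosets {m : ℕ} {a x : R} (ha : a ∈ initialSubalgebra p m)
    (hx : x ∈ doubleCosets p m) : a * x ∈ doubleCosets p m := by
  have : doubleCosets p m ≤ (doubleCosets p m).comap (LinearMap.mulLeft ℂ a) := by
    refine doubleCosets_le (fun b hb => ?_) (fun b hb c hc => ?_) (fun b hb => ?_)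
    · exact mem_doubleCosets (mul_mem ha hb)
    · simpa [mul_assoc] using mul_gen_mul_mem_doubleCosets (mul_mem ha hb) hc
    · simpa [mul_assoc] using mul_palindrome_mem_doubleCosets (mul_mem ha hb)
  exact this hx

theorem HeckeSeq.doubleCosets_mul_mem (hp : HeckeSeq p) {m : ℕ} {a x : R}
    (ha : a ∈ initialSubalgebra p m) (hx : x ∈ doubleCosets p m) :
    x * a ∈ doubleCosets p m := by
  have : doubleCosets p m ≤ (doubleCosets p m).comap (LinearMap.mulRight ℂ a) := by
    refine doubleCosets_le (fun b hb => ?_) (fun b hb c hc => ?_) (fun b hb => ?_)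
    · exact mem_doubleCosets (mul_mem hb ha)
    · simpa [mul_assoc] using mul_gen_mul_mem_doubleCosets hb (mul_mem hc ha)
    · have := commute_initialSubalgebra (hp.commute_palindrome_of_lt m) ha
      simpa [mul_assoc, this.eq] using mul_palindrome_mem_doubleCosets (mul_mem hb ha)
  exact this hx

/-- The sum of double cosets contains 1, so it suffices that it is stable under left multiplication
by the generators. Only products `p m * a * p m` are not immediate: on the palindrome piece `p m`
acts by `-1`. -/
theorem HeckeSeq.initialSubalgebra_succ_le_of (hp : HeckeSeq p) (m : ℕ)
    (key : ∀ a ∈ initialSubalgebra p m, p m * a * p m ∈ doubleCosets p m) :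
    Subalgebra.toSubmodule (initialSubalgebra p (m + 1)) ≤ doubleCosets p m := by
  have hleft : ∀ x ∈ doubleCosets p m, p m * x ∈ doubleCosets p m := by
    have : doubleCosets p m ≤ (doubleCosets p m).comap (LinearMap.mulLeft ℂ (p m)) := by
      refine doubleCosets_le (fun b hb => ?_) (fun b hb c hc => ?_) (fun b hb => ?_)
      · simpa using mul_gen_mul_mem_doubleCosets (one_mem _) hb
      · simpa [mul_assoc] using hp.doubleCosets_mul_mem hc (key b hb)
      · have hcomm := commute_initialSubalgebra (hp.commute_palindrome_of_lt m) hb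
        have hsq : p m * palindrome p m = -palindrome p m := by
          cases m with
          | zero => exact hp.sq 0
          | succ m => simp only [palindrome, ← mul_assoc, hp.sq, neg_mul]
        have : p m * (b * palindrome p m) = -(b * palindrome p m) := by
          rw [← hcomm.eq, ← mul_assoc, hsq, neg_mul]
        simpa [this] using mul_palindrome_mem_doubleCosets hb
    exact this
  have hall : ∀ a ∈ initialSubalgebra p (m + 1), ∀ x ∈ doubleCosets p m,
      a * x ∈ doubleCosets p m := by
    intro a ha
    induction ha using Algebra.adjoin_induction with
    | mem x hx =>
      obtain ⟨j, hj, rfl⟩ := hx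
      rcases Nat.lt_succ_iff_lt_or_eq.1 hj with hj | rfl
      · exact fun x hx => mul_mem_doubleCosets (mem_initialSubalgebra hj) hx
      · exact hleft
    | algebraMap r =>
      intro x hx
      rw [← Algebra.smul_def]
      exact Submodule.smul_mem _ r hx
    | add x y _ _ hx hy =>
      intro z hz
      rw [add_mul]
      exact add_mem (hx z hz) (hy z hz)
    | mul x y _ _ hx hy =>
      intro z hz
      rw [mul_assoc]
      exact hx _ (hy z hz)
  intro a ha
  simpa using hall a ha 1 (mem_doubleCosets (one_mem _))

/-- Induction: the middle factor of `p (k + 1) * a * p (k + 1)` is split along the double cosets one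
level down, and `p (k + 1)` commutes with everything generated by `p₀, …, p_{k-1}`. -/
theorem HeckeSeq.initialSubalgebra_succ_le (hp : HeckeSeq p) (m : ℕ) :
    Subalgebra.toSubmodule (initialSubalgebra p (m + 1)) ≤ doubleCosets p m := by
  have base : ∀ m k : ℕ, (∀ j < k, j + 2 ≤ m) → ∀ a ∈ initialSubalgebra p k, p m * a = a * p m :=
    fun m k h a ha => commute_initialSubalgebra (fun j hj => (hp.comm j m (h j hj)).symm) ha
  induction m with
  | zero =>
    refine hp.initialSubalgebra_succ_le_of 0 fun a ha => ?_
    rw [base 0 0 (by simp) a ha, mul_assoc, hp.sq, mul_neg]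
    exact neg_mem (by simpa using mul_gen_mul_mem_doubleCosets ha (one_mem _))
  | succ k ih =>
    refine hp.initialSubalgebra_succ_le_of (k + 1) fun a ha => ?_
    have hc := base (k + 1) k (by omega)
    have hsub : ∀ a ∈ initialSubalgebra p k, a ∈ initialSubalgebra p (k + 1) := fun a ha =>
      Algebra.adjoin_mono (Set.image_mono (Set.Iio_subset_Iio (Nat.le_succ k))) ha
    have : doubleCosets p k ≤ (doubleCosets p (k + 1)).comap
        (LinearMap.mulRight ℂ (p (k + 1)) ∘ₗ LinearMap.mulLeft ℂ (p (k + 1))) := by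
      refine doubleCosets_le (fun b hb => ?_) (fun b hb c hc' => ?_) (fun b hb => ?_)
      · change p (k + 1) * b * p (k + 1) ∈ doubleCosets p (k + 1)
        rw [hc b hb, mul_assoc, hp.sq, mul_neg]
        exact neg_mem (by simpa using mul_gen_mul_mem_doubleCosets (hsub b hb) (one_mem _))
      · change p (k + 1) * (b * p k * c) * p (k + 1) ∈ doubleCosets p (k + 1)
        have e : p (k + 1) * (b * p k * c) * p (k + 1) =
            b * (p (k + 1) * p k * p (k + 1)) * c := by
          calc _ = (p (k + 1) * b) * p k * (c * p (k + 1)) := by simp only [mul_assoc]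
            _ = _ := by rw [hc b hb, ← hc c hc']; simp only [mul_assoc]
        rw [e]
        -- For `k = 0` there is no three-term braid relation, but `p 1 * p 0 * p 1` is itself the
        -- next palindrome.
        rcases Nat.eq_zero_or_pos k with rfl | hk
        · exact hp.doubleCosets_mul_mem (hsub c hc') (mul_palindrome_mem_doubleCosets (hsub b hb))
        · rw [← hp.braid k hk]
          have := mul_gen_mul_mem_doubleCosets (p := p)
            (mul_mem (hsub b hb) (mem_initialSubalgebra (Nat.lt_succ_self k)))
            (mul_mem (mem_initialSubalgebra (Nat.lt_succ_self k)) (hsub c hc'))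
          simpa only [mul_assoc] using this
      · change p (k + 1) * (b * palindrome p k) * p (k + 1) ∈ doubleCosets p (k + 1)
        rw [← mul_assoc, hc b hb]
        simpa only [palindrome, mul_assoc] using
          mul_palindrome_mem_doubleCosets (p := p) (hsub b hb)
    exact this (ih ha)

theorem HeckeSeq.fg_initialSubalgebra (hp : HeckeSeq p) (m : ℕ) :
    (Subalgebra.toSubmodule (initialSubalgebra p m)).FG := by
  induction m with
  | zero =>
    have : initialSubalgebra p 0 = ⊥ := by simp [initialSubalgebra]
    rw [this]
    exact Subalgebra.fg_bot_toSubmodule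
  | succ m ih =>
    have hX : (doubleCosets p m).FG :=
      (ih.sup ((ih.mul (Submodule.fg_span_singleton _)).mul ih)).sup
        (ih.mul (Submodule.fg_span_singleton _))
    exact hX.of_le (hp.initialSubalgebra_succ_le m)

end HeckeSeq

/-! ### Finite-dimensionality for the presented algebra. -/

variable {n : ℕ}

theorem adjoin_range_gen : Algebra.adjoin ℂ (Set.range (gen : Fin n → HeckeB n)) = ⊤ := by
  have h : (Set.range (gen : Fin n → HeckeB n)) =
      RingQuot.mkAlgHom ℂ (HeckeRel n) '' Set.range (FreeAlgebra.ι ℂ) := by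
    rw [← Set.range_comp]; rfl
  rw [h, ← AlgHom.map_adjoin, FreeAlgebra.adjoin_range_ι, Algebra.map_top]
  exact (AlgHom.range_eq_top _).2 (RingQuot.mkAlgHom_surjective ℂ _)

theorem gen_rel {x y : FreeAlgebra ℂ (Fin n)} (h : HeckeRel n x y) :
    RingQuot.mkAlgHom ℂ (HeckeRel n) x = RingQuot.mkAlgHom ℂ (HeckeRel n) y :=
  RingQuot.mkAlgHom_rel ℂ h

/-- The generators of `H_n^B(0)`, extended by zero. -/
noncomputable def genSeq (n : ℕ) (i : ℕ) : HeckeB n := if h : i < n then gen ⟨i, h⟩ else 0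

theorem heckeSeq_genSeq (n : ℕ) : HeckeSeq (genSeq n) where
  sq i := by
    unfold genSeq gen
    split_ifs with h
    · simpa using gen_rel (HeckeRel.sq ⟨i, h⟩)
    · simp
  comm i j hij := by
    unfold genSeq gen Commute SemiconjBy
    split_ifs with h h' h'
    · simpa using gen_rel (HeckeRel.comm ⟨i, h⟩ ⟨j, h'⟩ hij)
    all_goals simp
  braid i hi := by
    unfold genSeq gen
    split_ifs with h h' h'
    · simpa using gen_rel (HeckeRel.braid ⟨i, h⟩ ⟨i + 1, h'⟩ hi rfl)
    all_goals simp
  braidFour := by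
    unfold genSeq gen
    split_ifs with h h' h'
    · simpa using gen_rel (HeckeRel.braidFour ⟨0, h⟩ ⟨1, h'⟩ rfl rfl)
    all_goals simp

instance finite_heckeB (n : ℕ) : Module.Finite ℂ (HeckeB n) := by
  have htop : initialSubalgebra (genSeq n) n = ⊤ := by
    rw [← top_le_iff, ← adjoin_range_gen]
    refine Algebra.adjoin_mono ?_
    rintro _ ⟨i, rfl⟩
    exact ⟨i, i.2, by simp [genSeq]⟩
  have := (heckeSeq_genSeq n).fg_initialSubalgebra n
  rw [htop] at this
  exact ⟨by simpa using this⟩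

/-- This makes submodules of finitely generated modules finitely generated, so that the steps of a
filtration have classes in `G0`. -/
instance isNoetherianRing_heckeB (n : ℕ) : IsNoetherianRing (HeckeB n) :=
  IsNoetherianRing.of_finite ℂ (HeckeB n)

/-! ### Fundamental type-`B` quasisymmetric functions -/

theorem coeff_FB (I : Finset (Fin n)) (m : ℕ →₀ ℕ) :
    MvPowerSeries.coeff m (FB I) = (Nat.card {i : Fin (n + 1) → ℕ // i 0 = 0 ∧ Monotone i ∧
      (∀ j ∈ I, i j.castSucc < i j.succ) ∧
      ∑ k : Fin n, Finsupp.single (i k.succ) 1 = m} : ℂ) := rfl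

/-- Composition with `φ` is a bijection between the index sequences counted on the two sides. -/
theorem coeff_mapDomain_FB (I : Finset (Fin n)) {φ : ℕ → ℕ} (hφ : StrictMono φ) (h0 : φ 0 = 0)
    (m : ℕ →₀ ℕ) :
    MvPowerSeries.coeff (m.mapDomain φ) (FB I) = MvPowerSeries.coeff m (FB I) := by
  have hsum : ∀ i : Fin (n + 1) → ℕ, ∑ k : Fin n, Finsupp.single (φ (i k.succ)) 1 =
      (∑ k : Fin n, Finsupp.single (i k.succ) 1 : ℕ →₀ ℕ).mapDomain φ := fun i => by
    rw [Finsupp.mapDomain_finsetSum]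
    simp [Finsupp.mapDomain_single]
  rw [coeff_FB, coeff_FB]
  congr 1
  symm
  refine Nat.card_congr (Equiv.ofBijective (fun i => ⟨φ ∘ i.1, ?_⟩) ⟨?_, ?_⟩)
  · obtain ⟨i, h1, h2, h3, h4⟩ := i
    refine ⟨by simp [h1, h0], hφ.monotone.comp h2, fun j hj => hφ (h3 j hj), ?_⟩
    simp only [Function.comp_apply, hsum, h4]
  · intro i i' h
    exact Subtype.ext (hφ.injective.comp_left (congrArg Subtype.val h))
  · rintro ⟨i, h1, h2, h3, h4⟩
    -- Surjectivity: the initial entry is `0 = φ 0`, and every other entry is a variable of the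
    -- relabelled monomial, hence lies in the range of `φ`.
    have hr : ∀ k, ∃ a, φ a = i k := by
      refine Fin.cases ⟨0, by rw [h0, h1]⟩ fun k => ?_
      have : i k.succ ∈ (m.mapDomain φ).support := by
        rw [← h4, Finsupp.mem_support_iff, Finsupp.finsetSum_apply]
        refine (Finset.sum_pos' (fun _ _ => Nat.zero_le _) ⟨k, Finset.mem_univ k, ?_⟩).ne'
        simp
      obtain ⟨a, -, ha⟩ := Finset.mem_image.1 (Finsupp.mapDomain_support this)
      exact ⟨a, ha⟩
    choose i' hi' using hr
    obtain rfl : φ ∘ i' = i := funext hi'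
    refine ⟨⟨i', hφ.injective (by rw [h0]; exact h1), fun a b hab => hφ.le_iff_le.1 (h2 hab),
      fun j hj => hφ.lt_iff_lt.1 (h3 j hj), ?_⟩, rfl⟩
    refine Finsupp.mapDomain_injective hφ.injective ?_
    rw [← hsum, ← h4]
    rfl

theorem FB_mem_QSymB (I : Finset (Fin n)) : FB I ∈ QSymB := by
  refine ⟨⟨n, fun m hm => ?_⟩, fun φ hφ h0 m => coeff_mapDomain_FB I hφ h0 m⟩
  rw [coeff_FB, Nat.cast_ne_zero] at hm
  obtain ⟨⟨i, -, -, -, rfl⟩⟩ := (Nat.card_ne_zero.1 hm).1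
  simp [Finsupp.degree_single]

/-! ### Traces and the Grothendieck group -/

/-- A linear splitting gives `f ∘ r' + s ∘ g = id`. Inserting this after `b` and rotating both
traces cyclically leaves `a` on one side and `c` on the other, so no block matrices are needed. -/
theorem trace_eq_add_of_exact {K A B C : Type*} [Field K] [AddCommGroup A] [Module K A]
    [AddCommGroup B] [Module K B] [AddCommGroup C] [Module K C] [FiniteDimensional K A]
    [FiniteDimensional K B] [FiniteDimensional K C] {f : A →ₗ[K] B} {g : B →ₗ[K] C}
    (hf : Function.Injective f) (hfg : Function.Exact f g) (hg : Function.Surjective g)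
    {a : Module.End K A} {b : Module.End K B} {c : Module.End K C}
    (hab : b ∘ₗ f = f ∘ₗ a) (hbc : g ∘ₗ b = c ∘ₗ g) :
    LinearMap.trace K B b = LinearMap.trace K A a + LinearMap.trace K C c := by
  obtain ⟨s, hs⟩ := g.exists_rightInverse_of_surjective (LinearMap.range_eq_top.2 hg)
  obtain ⟨r, hr⟩ := f.exists_leftInverse_of_injective (LinearMap.ker_eq_bot.2 hf)
  have hrf : ∀ x, r (f x) = x := fun x => LinearMap.congr_fun hr x
  have hgs : ∀ x, g (s x) = x := fun x => LinearMap.congr_fun hs x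
  have hgf : ∀ x, g (f x) = 0 := fun x => (hfg _).2 ⟨x, rfl⟩
  let r' : B →ₗ[K] A := r ∘ₗ (LinearMap.id - s ∘ₗ g)
  have h1 : f ∘ₗ r' + s ∘ₗ g = LinearMap.id := by
    ext y
    obtain ⟨x, hx⟩ := (hfg (y - s (g y))).1 (by simp [hgs])
    simp only [r', LinearMap.add_apply, LinearMap.comp_apply, LinearMap.sub_apply,
      LinearMap.id_apply, ← hx, hrf]
    rw [hx, sub_add_cancel]
  have h2 : r' ∘ₗ f = LinearMap.id := by
    ext x
    simp [r', hgf, hrf]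
  calc LinearMap.trace K B b = LinearMap.trace K B (b ∘ₗ (f ∘ₗ r' + s ∘ₗ g)) := by
        rw [h1, LinearMap.comp_id]
    _ = LinearMap.trace K B ((f ∘ₗ a) ∘ₗ r') + LinearMap.trace K B ((b ∘ₗ s) ∘ₗ g) := by
        rw [LinearMap.comp_add, map_add, ← hab]; rfl
    _ = LinearMap.trace K A (r' ∘ₗ (f ∘ₗ a)) + LinearMap.trace K C (g ∘ₗ (b ∘ₗ s)) := by
        rw [LinearMap.trace_comp_comm' (f ∘ₗ a) r', LinearMap.trace_comp_comm' (b ∘ₗ s) g]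
    _ = _ := by
        rw [← LinearMap.comp_assoc, h2, ← LinearMap.comp_assoc, hbc, LinearMap.comp_assoc, hs]
        rfl

/-- The complex vector space structure of a module over `H_n^B(0)`. -/
noncomputable instance FGMod.moduleComplex (M : FGMod n) : Module ℂ M.carrier :=
  Module.compHom M.carrier (algebraMap ℂ (HeckeB n))

instance FGMod.isScalarTower (M : FGMod n) : IsScalarTower ℂ (HeckeB n) M.carrier where
  smul_assoc c a v := by
    rw [Algebra.smul_def, mul_smul]
    rfl

instance FGMod.finiteDimensional (M : FGMod n) : FiniteDimensional ℂ M.carrier :=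
  Module.Finite.trans (HeckeB n) M.carrier

/-- The trace of an element of `H_n^B(0)` on a module. -/
noncomputable def FGMod.trace (M : FGMod n) (a : HeckeB n) : ℂ :=
  LinearMap.trace ℂ M.carrier (Module.toModuleEnd ℂ M.carrier a)

theorem FGMod.trace_eq_add_of_exact {A B C : FGMod n} {f : A.carrier →ₗ[HeckeB n] B.carrier}
    {g : B.carrier →ₗ[HeckeB n] C.carrier} (hf : Function.Injective f)
    (hfg : Function.Exact f g) (hg : Function.Surjective g) (a : HeckeB n) :
    B.trace a = A.trace a + C.trace a := by
  refine DominoHecke.trace_eq_add_of_exact (f := f.restrictScalars ℂ) (g := g.restrictScalars ℂ)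
    hf hfg hg ?_ ?_
  · ext x; exact (f.map_smul a x).symm
  · ext x; exact g.map_smul a x

@[simp]
theorem simpleChar_gen (I : Finset (Fin n)) (j : Fin n) :
    simpleChar I (gen j) = if j ∈ I then -1 else 0 := by
  simp [simpleChar, gen]

/-- The complex structure of an `FGMod` is restricted from the algebra and need not be the given one
on `V`. An additive equivalence respecting the action is automatically complex linear, because
scalars act through `ρ`. -/
theorem FGMod.trace_eq_of_addEquiv (M : FGMod n) {V : Type} [AddCommGroup V] [Module ℂ V]
    (ρ : HeckeB n →ₐ[ℂ] Module.End ℂ V) (e : M.carrier ≃+ V) (he : ∀ a v, e (a • v) = ρ a (e v))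
    (a : HeckeB n) : M.trace a = LinearMap.trace ℂ V (ρ a) := by
  let e' : M.carrier ≃ₗ[ℂ] V :=
    { e with
      map_smul' := fun c v => by
        change e (algebraMap ℂ (HeckeB n) c • v) = c • e v
        rw [he, AlgHom.commutes, Module.algebraMap_end_apply] }
  rw [FGMod.trace, ← LinearMap.trace_conj' _ e']
  congr 1
  ext v
  change e (a • e.symm v) = _
  rw [he, e.apply_symm_apply]

theorem trace_repModule {V : Type} [AddCommGroup V] [Module ℂ V] [Module.Finite ℂ V]
    (ρ : HeckeB n →ₐ[ℂ] Module.End ℂ V) (a : HeckeB n) :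
    (FGMod.mk (RepModule ρ)).trace a = LinearMap.trace ℂ V (ρ a) :=
  FGMod.trace_eq_of_addEquiv (FGMod.mk (RepModule ρ)) ρ (AddEquiv.refl V) (fun _ _ => rfl) a

theorem trace_simpleB (I : Finset (Fin n)) (a : HeckeB n) :
    (FGMod.mk (SimpleB I)).trace a = simpleChar I a := by
  have h : ((Algebra.ofId ℂ (Module.End ℂ ℂ)).comp (simpleChar I)) a =
      simpleChar I a • LinearMap.id := by
    ext
    simp [Algebra.ofId_apply, Module.algebraMap_end_apply]
  rw [trace_repModule, h, map_smul, LinearMap.trace_id]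
  simp

/-- An element of `H_n^B(0)` acting as `1` on `S_I^B` and as `0` on the other simple modules. -/
noncomputable def selector (I : Finset (Fin n)) : HeckeB n :=
  (List.ofFn fun j => if j ∈ I then -gen j else 1 + gen j).prod

/-- On `S_J^B` the factors `-gen j` and `1 + gen j` act as the indicators of `j ∈ J` and `j ∉ J`. -/
theorem simpleChar_selector (I J : Finset (Fin n)) :
    simpleChar J (selector I) = if I = J then 1 else 0 := by
  have h : ∀ j : Fin n, simpleChar J (if j ∈ I then -gen j else 1 + gen j) =
      if (j ∈ I ↔ j ∈ J) then 1 else 0 := by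
    intro j
    by_cases h1 : j ∈ I <;> by_cases h2 : j ∈ J <;> simp [h1, h2]
  rw [selector, map_list_prod, List.map_ofFn, List.prod_ofFn]
  simp only [Function.comp_apply, h, Finset.prod_ite_zero, Finset.prod_const_one]
  simp [Finset.ext_iff]

/-- The type-`B` quasisymmetric characteristic, as a combination of traces. -/
noncomputable def characteristic (n : ℕ) : G0 n →+ QSymB :=
  QuotientAddGroup.lift _
    (FreeAbelianGroup.lift fun M : FGMod n =>
      ∑ I : Finset (Fin n), M.trace (selector I) • (⟨FB I, FB_mem_QSymB I⟩ : QSymB)) <| by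
    rw [AddSubgroup.closure_le]
    rintro _ ⟨A, B, C, f, g, hf, hfg, hg, rfl⟩
    simp only [SetLike.mem_coe, AddMonoidHom.mem_ker, map_add, map_sub,
      FreeAbelianGroup.lift_apply_of, ← Finset.sum_sub_distrib, ← Finset.sum_add_distrib]
    refine Finset.sum_eq_zero fun I _ => ?_
    rw [FGMod.trace_eq_add_of_exact hf hfg hg, add_smul]
    abel

theorem isCharB_characteristic (n : ℕ) : IsCharB (characteristic n) := by
  intro J
  have : characteristic n (G0.cls n (SimpleB J)) =
      ∑ I : Finset (Fin n), (FGMod.mk (SimpleB J)).trace (selector I) •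
        (⟨FB I, FB_mem_QSymB I⟩ : QSymB) := FreeAbelianGroup.lift_apply_of _ _
  rw [this]
  simp [trace_simpleB, simpleChar_selector]

theorem cls_eq_add_of_exact {A B C : Type} [AddCommGroup A] [Module (HeckeB n) A]
    [Module.Finite (HeckeB n) A] [AddCommGroup B] [Module (HeckeB n) B]
    [Module.Finite (HeckeB n) B] [AddCommGroup C] [Module (HeckeB n) C]
    [Module.Finite (HeckeB n) C] {f : A →ₗ[HeckeB n] B} {g : B →ₗ[HeckeB n] C}
    (hf : Function.Injective f) (hfg : Function.Exact f g) (hg : Function.Surjective g) :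
    G0.cls n B = G0.cls n A + G0.cls n C := by
  have h : (QuotientAddGroup.mk (FreeAbelianGroup.of (FGMod.mk A) -
      FreeAbelianGroup.of (FGMod.mk B) + FreeAbelianGroup.of (FGMod.mk C)) : G0 n) = 0 :=
    (QuotientAddGroup.eq_zero_iff _).2
      (AddSubgroup.subset_closure ⟨FGMod.mk A, FGMod.mk B, FGMod.mk C, f, g, hf, hfg, hg, rfl⟩)
  change G0.cls n A - G0.cls n B + G0.cls n C = 0 at h
  rw [← sub_eq_zero, ← neg_eq_zero, ← h]
  abel

/-! ### Classes of modules with a triangular basis -/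

section Triangular

/-- With `A` zero, the sequence `A → A → A` of identity maps is short exact and gives `[A] = [A] +
[A]`. -/
theorem cls_eq_zero_of_subsingleton (A : Type) [AddCommGroup A] [Module (HeckeB n) A]
    [Module.Finite (HeckeB n) A] [Subsingleton A] : G0.cls n A = 0 := by
  have h := cls_eq_add_of_exact (n := n) (f := (LinearMap.id : A →ₗ[HeckeB n] A))
    (g := (LinearMap.id : A →ₗ[HeckeB n] A)) Function.injective_id
    (fun y => by simp [Subsingleton.elim y 0]) Function.surjective_id
  exact left_eq_add.1 h

theorem cls_congr {A B : Type} [AddCommGroup A] [Module (HeckeB n) A]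
    [Module.Finite (HeckeB n) A] [AddCommGroup B] [Module (HeckeB n) B]
    [Module.Finite (HeckeB n) B] (e : A ≃ₗ[HeckeB n] B) : G0.cls n A = G0.cls n B := by
  have h := cls_eq_add_of_exact (n := n) (f := e.toLinearMap) (g := (0 : B →ₗ[HeckeB n] PUnit))
    e.injective (fun y => by simp) (fun y => ⟨0, rfl⟩)
  rw [h, cls_eq_zero_of_subsingleton PUnit, add_zero]

theorem heckeB_induction {P : HeckeB n → Prop} (gen : ∀ i, P (gen i))
    (algebraMap : ∀ c, P (algebraMap ℂ (HeckeB n) c)) (add : ∀ a b, P a → P b → P (a + b))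
    (mul : ∀ a b, P a → P b → P (a * b)) (a : HeckeB n) : P a := by
  have ha : a ∈ Algebra.adjoin ℂ (Set.range (DominoHecke.gen : Fin n → HeckeB n)) := by
    rw [adjoin_range_gen]; trivial
  induction ha using Algebra.adjoin_induction with
  | mem x hx => obtain ⟨i, rfl⟩ := hx; exact gen i
  | algebraMap r => exact algebraMap r
  | add x y _ _ hx hy => exact add x y hx hy
  | mul x y _ _ hx hy => exact mul x y hx hy

variable {ι : Type} (ρ : HeckeB n →ₐ[ℂ] Module.End ℂ (ι →₀ ℂ)) (D : ι → Finset (Fin n))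
  (h : ι → ℕ)

/-- Each generator `π_i` acts on the basis vector `t` by `-1` or `0`, according to whether
`i ∈ D t`, up to basis vectors at which `h` is larger. -/
def IsTriangular : Prop :=
  ∀ i t, ∃ w ∈ Finsupp.supported ℂ ℂ {t' | h t < h t'},
    ρ (gen i) (Finsupp.single t 1) =
      (if i ∈ D t then (-1 : ℂ) else 0) • Finsupp.single t 1 + w

variable {ρ D h}

theorem IsTriangular.map_mem_supported (H : IsTriangular ρ D h) {S : Set ι}
    (hS : ∀ t ∈ S, ∀ t', h t < h t' → t' ∈ S) (a : HeckeB n) :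
    ∀ v ∈ Finsupp.supported ℂ ℂ S, ρ a v ∈ Finsupp.supported ℂ ℂ S := by
  induction a using heckeB_induction with
  | gen i =>
    have : Finsupp.supported ℂ ℂ S ≤ (Finsupp.supported ℂ ℂ S).comap (ρ (gen i)) := by
      conv_lhs => rw [Finsupp.supported_eq_span_single]
      rw [Submodule.span_le]
      rintro _ ⟨t, ht, rfl⟩
      obtain ⟨w, hw, e⟩ := H i t
      rw [SetLike.mem_coe, Submodule.mem_comap, e]
      exact add_mem (Submodule.smul_mem _ _ (Finsupp.single_mem_supported ℂ 1 ht))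
        (Finsupp.supported_mono (fun t' ht' => hS t ht t' ht') hw)
    exact this
  | algebraMap c =>
    intro v hv
    rw [AlgHom.commutes, Module.algebraMap_end_apply]
    exact Submodule.smul_mem _ c hv
  | add a b ha hb =>
    intro v hv
    rw [map_add, LinearMap.add_apply]
    exact add_mem (ha v hv) (hb v hv)
  | mul a b ha hb =>
    intro v hv
    rw [map_mul, Module.End.mul_apply]
    exact ha _ (hb v hv)

/-- The error terms at any `s ∈ S` sit strictly above `h s ≥ h t`, so they never contribute at `t`.
This is the linearity of the quotient map onto the simple module of `D t`. -/
theorem IsTriangular.apply_apply_eq (H : IsTriangular ρ D h) {S : Set ι}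
    (hS : ∀ t ∈ S, ∀ t', h t < h t' → t' ∈ S) {t : ι} (ht : ∀ s ∈ S, h t ≤ h s) (a : HeckeB n) :
    ∀ v ∈ Finsupp.supported ℂ ℂ S, ρ a v t = simpleChar (D t) a * v t := by
  induction a using heckeB_induction with
  | gen i =>
    have : Finsupp.supported ℂ ℂ S ≤ LinearMap.eqLocus (Finsupp.lapply t ∘ₗ ρ (gen i))
        (simpleChar (D t) (gen i) • Finsupp.lapply t) := by
      rw [Finsupp.supported_eq_span_single, Submodule.span_le]
      rintro _ ⟨s, hs, rfl⟩
      obtain ⟨w, hw, e⟩ := H i s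
      have hwt : w t = 0 := by
        by_contra hne
        exact absurd (ht s hs) (not_le.2 (hw (Finsupp.mem_support_iff.2 hne)))
      by_cases hst : s = t
      · subst hst
        by_cases hi : i ∈ D s <;> simp [e, hwt, hi]
      · by_cases hi : i ∈ D s <;> by_cases hi' : i ∈ D t <;>
          simp [e, hwt, hi, hi', Finsupp.single_eq_of_ne (Ne.symm hst)]
    exact this
  | algebraMap c =>
    intro v hv
    rw [AlgHom.commutes, AlgHom.commutes, Module.algebraMap_end_apply]
    rfl
  | add a b ha hb =>
    intro v hv
    rw [map_add, LinearMap.add_apply, Finsupp.add_apply, ha v hv, hb v hv, map_add, add_mul]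
  | mul a b ha hb =>
    intro v hv
    rw [map_mul, Module.End.mul_apply, ha _ (H.map_mem_supported hS b v hv), hb v hv, map_mul,
      mul_assoc]

/-- The submodule of vectors supported in a set closed under increasing `h`. -/
def IsTriangular.supportedSubmodule (H : IsTriangular ρ D h) (S : Set ι)
    (hS : ∀ t ∈ S, ∀ t', h t < h t' → t' ∈ S) : Submodule (HeckeB n) (RepModule ρ) where
  carrier := {v | (v : ι →₀ ℂ) ∈ Finsupp.supported ℂ ℂ S}
  add_mem' hv hw := (Finsupp.supported ℂ ℂ S).add_mem hv hw
  zero_mem' := (Finsupp.supported ℂ ℂ S).zero_mem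
  smul_mem' a v hv := H.map_mem_supported hS a v hv

/-- The coefficient at an element minimizing `h`, as a map to a simple module. -/
noncomputable def IsTriangular.coeffMap (H : IsTriangular ρ D h) (S : Set ι)
    (hS : ∀ t ∈ S, ∀ t', h t < h t' → t' ∈ S) (t : ι) (ht : ∀ s ∈ S, h t ≤ h s) :
    H.supportedSubmodule S hS →ₗ[HeckeB n] SimpleB (D t) where
  toFun v := Finsupp.lapply (R := ℂ) (M := ℂ) t v.1
  map_add' _ _ := rfl
  map_smul' a v := H.apply_apply_eq hS ht a v.1 v.2

variable [Finite ι]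

theorem IsTriangular.cls_supportedSubmodule (H : IsTriangular ρ D h) (S : Finset ι)
    (hS : ∀ t ∈ (S : Set ι), ∀ t', h t < h t' → t' ∈ (S : Set ι)) :
    G0.cls n (H.supportedSubmodule S hS) = ∑ t ∈ S, G0.cls n (SimpleB (D t)) := by
  classical
  induction S using Finset.strongInduction with
  | H S ih =>
    rcases S.eq_empty_or_nonempty with rfl | hne
    · have : Subsingleton (H.supportedSubmodule ((∅ : Finset ι) : Set ι) hS) := by
        refine ⟨fun v w => Subtype.ext ?_⟩
        have hv := v.2
        have hw := w.2
        simp only [IsTriangular.supportedSubmodule, Finset.coe_empty, Finsupp.supported_empty]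
          at hv hw
        exact Eq.trans hv (Eq.symm hw)
      rw [cls_eq_zero_of_subsingleton, Finset.sum_empty]
    · obtain ⟨t, htS, ht⟩ := S.exists_min_image h hne
      -- Erasing a minimizer keeps the set closed upwards, since `t` is not strictly above any
      -- element of `S`.
      have hS' : ∀ s ∈ ((S.erase t : Finset ι) : Set ι), ∀ t', h s < h t' →
          t' ∈ ((S.erase t : Finset ι) : Set ι) := by
        intro s hs t' hst
        have hs' := Finset.mem_of_mem_erase (Finset.mem_coe.1 hs)
        refine Finset.mem_coe.2 (Finset.mem_erase.2 ⟨?_, hS s hs' t' hst⟩)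
        rintro rfl
        exact absurd (ht s hs') (not_le.2 hst)
      have hle : H.supportedSubmodule (S.erase t : Finset ι) hS' ≤ H.supportedSubmodule S hS :=
        fun v hv => Finsupp.supported_mono (M := ℂ) (R := ℂ)
          (Finset.coe_subset.2 (S.erase_subset t)) hv
      rw [← Finset.sum_erase_add S _ htS, ← ih _ (Finset.erase_ssubset htS) hS']
      refine cls_eq_add_of_exact (f := Submodule.inclusion hle) (g := H.coeffMap S hS t ht)
        (Submodule.inclusion_injective hle) ?_ ?_
      · intro v
        constructor
        · intro hv
          refine ⟨⟨v.1, ?_⟩, rfl⟩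
          intro s hs
          refine Finset.mem_coe.2 (Finset.mem_erase.2 ⟨?_, v.2 hs⟩)
          rintro rfl
          exact Finsupp.mem_support_iff.1 hs hv
        · rintro ⟨w, rfl⟩
          by_contra hne
          exact Finset.notMem_erase t S (w.2 (Finsupp.mem_support_iff.2 hne))
      · intro c
        exact ⟨⟨(Finsupp.single t (c : ℂ) : ι →₀ ℂ), Finsupp.single_mem_supported ℂ _ htS⟩,
          Finsupp.single_eq_same⟩

theorem IsTriangular.cls_repModule [Fintype ι] (H : IsTriangular ρ D h) :
    G0.cls n (RepModule ρ) = ∑ t, G0.cls n (SimpleB (D t)) := by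
  have hu : ∀ t ∈ ((Finset.univ : Finset ι) : Set ι), ∀ t', h t < h t' →
      t' ∈ ((Finset.univ : Finset ι) : Set ι) := by simp
  have htop : H.supportedSubmodule (Finset.univ : Finset ι) hu = ⊤ :=
    eq_top_iff.2 fun v _ => by
      intro t _
      simp
  rw [← H.cls_supportedSubmodule Finset.univ hu]
  exact (cls_congr ((LinearEquiv.ofEq _ _ htop).trans Submodule.topEquiv)).symm

end Triangular

/-! ### Sorting operators on words -/

section Words

variable {κ α : Type*} [DecidableEq κ] (r : α → α → Prop)

open Classical in
/-- The 0-Hecke operator on words that compares the letters in positions `j` and `i`. -/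
noncomputable def sortOp (j i : κ) : Module.End ℂ ((κ → α) →₀ ℂ) :=
  Finsupp.linearCombination ℂ fun w =>
    if r (w j) (w i) then -Finsupp.single w 1
    else if r (w i) (w j) then Finsupp.single (w ∘ Equiv.swap j i) 1 else 0

variable {r} {j i : κ} {w : κ → α}

theorem sortOp_of_rel (h : r (w j) (w i)) :
    sortOp r j i (Finsupp.single w 1) = -Finsupp.single w 1 := by
  simp [sortOp, h]

theorem sortOp_of_rel_swap [Std.Asymm r] (h : r (w i) (w j)) :
    sortOp r j i (Finsupp.single w 1) = Finsupp.single (w ∘ Equiv.swap j i) 1 := by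
  simp [sortOp, h, asymm h]

theorem sortOp_of_not_rel (h : ¬r (w j) (w i)) (h' : ¬r (w i) (w j)) :
    sortOp r j i (Finsupp.single w 1) = 0 := by
  simp [sortOp, h, h']

theorem sortOp_mul_self [Std.Asymm r] (j i : κ) : sortOp r j i * sortOp r j i = -sortOp r j i := by
  refine Finsupp.lhom_ext' fun w => LinearMap.ext_ring ?_
  change sortOp r j i (sortOp r j i (Finsupp.single w 1)) = -sortOp r j i (Finsupp.single w 1)
  by_cases h : r (w j) (w i)
  · rw [sortOp_of_rel h, map_neg, sortOp_of_rel h]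
  by_cases h' : r (w i) (w j)
  · rw [sortOp_of_rel_swap h', sortOp_of_rel (by simpa using h')]
  · simp [sortOp_of_not_rel h h']

theorem sortOp_mul_comm {j i l k : κ} (h1 : j ≠ l) (h2 : j ≠ k) (h3 : i ≠ l) (h4 : i ≠ k) :
    sortOp r j i * sortOp r l k = sortOp r l k * sortOp r j i := by
  refine Finsupp.lhom_ext' fun w => LinearMap.ext_ring ?_
  change sortOp r j i (sortOp r l k (Finsupp.single w 1)) =
    sortOp r l k (sortOp r j i (Finsupp.single w 1))
  have e1 : ∀ w : κ → α, (w ∘ Equiv.swap l k) j = w j := fun w => by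
    simp [Equiv.swap_apply_of_ne_of_ne h1 h2]
  have e2 : ∀ w : κ → α, (w ∘ Equiv.swap l k) i = w i := fun w => by
    simp [Equiv.swap_apply_of_ne_of_ne h3 h4]
  have e3 : ∀ w : κ → α, (w ∘ Equiv.swap j i) l = w l := fun w => by
    simp [Equiv.swap_apply_of_ne_of_ne h1.symm h3.symm]
  have e4 : ∀ w : κ → α, (w ∘ Equiv.swap j i) k = w k := fun w => by
    simp [Equiv.swap_apply_of_ne_of_ne h2.symm h4.symm]
  have e5 : (w ∘ Equiv.swap l k) ∘ Equiv.swap j i = (w ∘ Equiv.swap j i) ∘ Equiv.swap l k := by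
    funext x
    simp only [Function.comp_apply, Equiv.swap_apply_def]
    split_ifs <;> simp_all
  by_cases a : r (w j) (w i) <;> by_cases a' : r (w i) (w j) <;>
  by_cases b : r (w l) (w k) <;> by_cases b' : r (w k) (w l) <;>
  simp_all [sortOp]

variable [IsStrictOrder α r]

/-- A check over the relative order of three letters, incomparable pairs included. Transitivity
rules out the cases in which one side would vanish and the other would not. -/
theorem braid_of_rel {M : Type*} [AddCommGroup M] [Module ℂ M] (A B : Module.End ℂ M)
    (v : α → α → α → M)
    (hA : ∀ x y z, r x y → A (v x y z) = -v x y z)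
    (hA' : ∀ x y z, r y x → A (v x y z) = v y x z)
    (hA0 : ∀ x y z, ¬r x y → ¬r y x → A (v x y z) = 0)
    (hB : ∀ x y z, r y z → B (v x y z) = -v x y z)
    (hB' : ∀ x y z, r z y → B (v x y z) = v x z y)
    (hB0 : ∀ x y z, ¬r y z → ¬r z y → B (v x y z) = 0) (a b c : α) :
    A (B (A (v a b c))) = B (A (B (v a b c))) := by
  have tr : ∀ {x y z}, r x y → r y z → r x z := fun h h' => _root_.trans h h'
  have as : ∀ {x y}, r x y → ¬r y x := fun h => asymm h
  by_cases h1 : r a b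
  · have h1' := as h1
    by_cases h2 : r b c
    · have h2' := as h2
      simp [*]
    by_cases h2' : r c b
    · by_cases h3 : r a c
      · have h3' := as h3
        simp [*]
      by_cases h3' : r c a
      · simp [*]
      · simp [*]
    · simp [*]
  by_cases h1' : r b a
  · by_cases h2 : r b c
    · have h2' := as h2
      by_cases h3 : r a c
      · have h3' := as h3
        simp [*]
      by_cases h3' : r c a
      · simp [*]
      · simp [*]
    by_cases h2' : r c b
    · have h3 := tr h2' h1'
      have h3' := as h3
      simp [*]
    · by_cases h3 : r a c
      · exact absurd (tr h1' h3) h2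
      by_cases h3' : r c a
      · simp [*]
      · simp [*]
  · by_cases h2 : r b c
    · simp [*]
    by_cases h2' : r c b
    · by_cases h3 : r a c
      · exact absurd (tr h3 h2') h1
      by_cases h3' : r c a
      · simp [*]
      · simp [*]
    · simp [*]

theorem sortOp_braid {a b c : κ} (hab : a ≠ b) (hac : a ≠ c) (hbc : b ≠ c) :
    sortOp r a b * sortOp r b c * sortOp r a b = sortOp r b c * sortOp r a b * sortOp r b c := by
  refine Finsupp.lhom_ext' fun w => LinearMap.ext_ring ?_
  let u : α → α → α → κ → α := fun x y z k =>
    if k = a then x else if k = b then y else if k = c then z else w k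
  have ua : ∀ x y z, u x y z a = x := fun x y z => by simp [u]
  have ub : ∀ x y z, u x y z b = y := fun x y z => by simp [u, hab.symm]
  have uc : ∀ x y z, u x y z c = z := fun x y z => by simp [u, hac.symm, hbc.symm]
  have hs1 : ∀ x y z, u x y z ∘ Equiv.swap a b = u y x z := fun x y z => by
    funext k
    simp only [Function.comp_apply, Equiv.swap_apply_def, u]
    split_ifs <;> simp_all
  have hs2 : ∀ x y z, u x y z ∘ Equiv.swap b c = u x z y := fun x y z => by
    funext k
    simp only [Function.comp_apply, Equiv.swap_apply_def, u]
    split_ifs <;> simp_all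
  have hw : u (w a) (w b) (w c) = w := by
    funext k
    simp only [u]
    split_ifs <;> simp_all
  have := braid_of_rel (r := r) (sortOp r a b) (sortOp r b c)
    (fun x y z => Finsupp.single (u x y z) (1 : ℂ))
    (fun x y z h => sortOp_of_rel (by rwa [ua, ub]))
    (fun x y z h => by rw [sortOp_of_rel_swap (by rwa [ua, ub]), hs1])
    (fun x y z h h' => sortOp_of_not_rel (by rwa [ua, ub]) (by rwa [ua, ub]))
    (fun x y z h => sortOp_of_rel (by rwa [ub, uc]))
    (fun x y z h => by rw [sortOp_of_rel_swap (by rwa [ub, uc]), hs2])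
    (fun x y z h h' => sortOp_of_not_rel (by rwa [ub, uc]) (by rwa [ub, uc])) (w a) (w b) (w c)
  simp only [hw] at this
  exact this

end Words

/-! ### Geometry of standard domino tableaux -/

section Tableaux

/-- `d` lies strictly above `e`. -/
def IsAbove (d e : Finset (ℕ × ℕ)) : Prop :=
  d.Nonempty ∧ e.Nonempty ∧ ∀ a ∈ d, ∀ b ∈ e, a.1 < b.1

instance : IsStrictOrder (Finset (ℕ × ℕ)) IsAbove where
  irrefl := by
    rintro d ⟨⟨a, ha⟩, -, h⟩
    exact lt_irrefl _ (h a ha a ha)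
  trans := by
    rintro d e f ⟨hd, ⟨b, hb⟩, h⟩ ⟨-, hf, h'⟩
    exact ⟨hd, hf, fun a ha c hc => (h a ha b hb).trans (h' b hb c hc)⟩

theorem nonempty_of_isDomino {d : Finset (ℕ × ℕ)} (hd : IsHorizontal d ∨ IsVertical d) :
    d.Nonempty := by
  rcases hd with ⟨r, c, rfl⟩ | ⟨r, c, rfl⟩ <;> simp

/-- The rows met by a domino form an interval, and disjoint intervals are comparable. -/
theorem exists_row_eq_of_not_isAbove {d e : Finset (ℕ × ℕ)} (hd : IsHorizontal d ∨ IsVertical d)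
    (he : IsHorizontal e ∨ IsVertical e) (h : ¬IsAbove d e) (h' : ¬IsAbove e d) :
    ∃ a ∈ d, ∃ b ∈ e, a.1 = b.1 := by
  by_contra! hne
  have hdn := nonempty_of_isDomino hd
  have hen := nonempty_of_isDomino he
  simp only [IsAbove, hdn, hen, true_and] at h h'
  push Not at h h'
  rcases hd with ⟨r, c, rfl⟩ | ⟨r, c, rfl⟩ <;> rcases he with ⟨s, t, rfl⟩ | ⟨s, t, rfl⟩ <;>
    simp at h h' hne <;> omega

variable {μ : YoungDiagram} (T : SDT μ n)

theorem SDT.nonempty_dom (k : Fin n) : (T.dom k).Nonempty := nonempty_of_isDomino (T.isDomino k)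

theorem SDT.dom_injective : Function.Injective (SDT.dom : SDT μ n → _) := fun _ _ h => SDT.ext h

theorem SDT.mem_cells {c : ℕ × ℕ} : c ∈ μ.cells ↔ ∃ k, c ∈ T.dom k := by
  simp [← T.cover]

theorem SDT.eq_of_mem {k l : Fin n} {c : ℕ × ℕ} (hk : c ∈ T.dom k) (hl : c ∈ T.dom l) :
    k = l := by
  by_contra h
  exact Finset.disjoint_left.1 (T.disjoint k l h) hk hl

/-- The cell in the row of `a` and the column of `b` belongs to the diagram; the row condition
compares `a` with it and the column condition compares it with `b`. -/
theorem SDT.le_of_mem {k l : Fin n} {a b : ℕ × ℕ} (ha : a ∈ T.dom k) (hb : b ∈ T.dom l)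
    (h : a ≤ b) : k ≤ l := by
  have hmid : (a.1, b.2) ∈ μ.cells :=
    μ.isLowerSet (show ((a.1, b.2) : ℕ × ℕ) ≤ b from ⟨h.1, le_rfl⟩) (T.mem_cells.2 ⟨l, hb⟩)
  obtain ⟨m, hm⟩ := T.mem_cells.1 hmid
  have h1 : k ≤ m := by
    rcases h.2.eq_or_lt with e | e
    · have : a = (a.1, b.2) := Prod.ext rfl e
      exact (T.eq_of_mem ha (this ▸ hm)).le
    · exact T.row_le k m a ha _ hm rfl e
  have h2 : m ≤ l := by
    rcases h.1.eq_or_lt with e | e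
    · have : b = (a.1, b.2) := Prod.ext e.symm rfl
      exact (T.eq_of_mem hm (this ▸ hb)).le
    · exact T.col_le m l _ hm b hb rfl e
  exact h1.trans h2

theorem SDT.exists_mem_of_le {l : Fin n} {a b : ℕ × ℕ} (hb : b ∈ T.dom l) (h : a ≤ b) :
    ∃ k ≤ l, a ∈ T.dom k := by
  obtain ⟨k, hk⟩ := T.mem_cells.1 (μ.isLowerSet h (T.mem_cells.2 ⟨l, hb⟩))
  exact ⟨k, T.le_of_mem hk hb h, hk⟩

theorem SDT.origin_mem {i : Fin n} (hi : i.val = 0) : (0, 0) ∈ T.dom i := by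
  obtain ⟨b, hb⟩ := T.nonempty_dom i
  obtain ⟨k, hk, h⟩ := T.exists_mem_of_le hb (show ((0, 0) : ℕ × ℕ) ≤ b from ⟨by simp, by simp⟩)
  have : k = i := Fin.ext (by have : k.val ≤ i.val := hk; omega)
  exact this ▸ h

theorem SDT.dom_zero {i : Fin n} (hi : i.val = 0) :
    T.dom i = {(0, 0), (0, 1)} ∨ T.dom i = {(0, 0), (1, 0)} := by
  have h := T.origin_mem hi
  rcases T.isDomino i with ⟨r, c, e⟩ | ⟨r, c, e⟩
  · left
    rw [e] at h ⊢
    simp at h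
    obtain ⟨rfl, rfl⟩ := h
    rfl
  · right
    rw [e] at h ⊢
    simp at h
    obtain ⟨rfl, rfl⟩ := h
    rfl

theorem isVertical_iff_of_mem_zero {d : Finset (ℕ × ℕ)}
    (hd : d = {(0, 0), (0, 1)} ∨ d = {(0, 0), (1, 0)}) :
    IsVertical d ↔ d = {(0, 0), (1, 0)} := by
  constructor
  · rintro ⟨r, c, e⟩
    rcases hd with rfl | rfl
    · exfalso
      have h1 : ((r, c) : ℕ × ℕ) ∈ ({(0, 0), (0, 1)} : Finset (ℕ × ℕ)) := by simp [e]
      have h2 : ((r + 1, c) : ℕ × ℕ) ∈ ({(0, 0), (0, 1)} : Finset (ℕ × ℕ)) := by simp [e]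
      simp at h1 h2
    · rfl
  · rintro rfl
    exact ⟨0, 0, rfl⟩

theorem pred_lt {i : Fin n} (hi : i.val ≠ 0) : pred i < i := by
  rw [Fin.lt_def, pred]
  simp only
  omega

theorem pred_ne {i : Fin n} (hi : i.val ≠ 0) : pred i ≠ i := (pred_lt hi).ne

theorem pred_val (i : Fin n) : (pred i).val = i.val - 1 := rfl

theorem mem_Des {i : Fin n} : i ∈ Des T ↔ IsDescent T i := by
  classical simp [Des]

theorem mem_Des_of_ne_zero {i : Fin n} (hi : i.val ≠ 0) :
    i ∈ Des T ↔ IsAbove (T.dom (pred i)) (T.dom i) := by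
  simp [mem_Des, IsDescent, hi, Nat.pos_of_ne_zero hi, IsAbove, T.nonempty_dom]

theorem mem_Des_of_eq_zero {i : Fin n} (hi : i.val = 0) :
    i ∈ Des T ↔ T.dom i = {(0, 0), (1, 0)} := by
  simp [mem_Des, IsDescent, hi, isVertical_iff_of_mem_zero (T.dom_zero hi)]

/-- Exchanging two consecutive entries, the larger of which lies strictly above. -/
def SDT.swap (i : Fin n) (hi : i.val ≠ 0) (h : IsAbove (T.dom i) (T.dom (pred i))) : SDT μ n where
  dom := T.dom ∘ Equiv.swap (pred i) i
  isDomino _ := T.isDomino _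
  disjoint k l hkl := T.disjoint _ _ ((Equiv.injective _).ne hkl)
  cover := by
    rw [← T.cover]
    ext c
    simp only [Finset.mem_biUnion, Finset.mem_univ, true_and, Function.comp_apply]
    exact (Equiv.swap (pred i) i).exists_congr_left.trans (by simp)
  row_le k l a ha b hb hr hc := by
    have h1 := T.row_le _ _ a ha b hb hr hc
    by_contra hlt
    have hpv := pred_val i
    -- Exchanging consecutive entries reverses the order of that pair only.
    have : k = i ∧ l = pred i := by
      simp only [Equiv.swap_apply_def, Fin.le_def, Fin.ext_iff, not_le] at *
      split_ifs at h1 <;> omega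
    obtain ⟨rfl, rfl⟩ := this
    simp only [Function.comp_apply, Equiv.swap_apply_left, Equiv.swap_apply_right] at ha hb
    exact (h.2.2 b hb a ha).ne hr.symm
  col_le k l a ha b hb hr hc := by
    have h1 := T.col_le _ _ a ha b hb hr hc
    by_contra hlt
    have hpv := pred_val i
    have : k = i ∧ l = pred i := by
      simp only [Equiv.swap_apply_def, Fin.le_def, Fin.ext_iff, not_le] at *
      split_ifs at h1 <;> omega
    obtain ⟨rfl, rfl⟩ := this
    simp only [Function.comp_apply, Equiv.swap_apply_left, Equiv.swap_apply_right] at ha hb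
    exact (h.2.2 b hb a ha).not_gt hc

/-! ### Values of the operators on tableaux, and transfer to words. -/

theorem opBasis_of_mem {T : SDT μ n} {i : Fin n} (h : i ∈ Des T) :
    opBasis i T = -Finsupp.single T 1 := by
  simp [opBasis, h]

theorem opBasis_of_eq_some {T T' : SDT μ n} {i : Fin n} (h : i ∉ Des T)
    (hT' : sFilling T i = some T'.dom) : opBasis i T = Finsupp.single T' 1 := by
  have hex : ∃ T' : SDT μ n, sFilling T i = some T'.dom := ⟨T', hT'⟩
  rw [opBasis, if_neg h, dif_pos hex]
  have : hex.choose = T' :=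
    SDT.dom_injective (Option.some_injective _ (hex.choose_spec.symm.trans hT'))
  rw [this]

theorem opBasis_of_forall_ne {T : SDT μ n} {i : Fin n} (h : i ∉ Des T)
    (hT : ∀ T' : SDT μ n, sFilling T i ≠ some T'.dom) : opBasis i T = 0 := by
  rw [opBasis, if_neg h, dif_neg (by simpa using hT)]

theorem opBasis_of_isAbove {T : SDT μ n} {i : Fin n} (hi : i.val ≠ 0)
    (h : IsAbove (T.dom i) (T.dom (pred i))) :
    opBasis i T = Finsupp.single (T.swap i hi h) 1 := by
  refine opBasis_of_eq_some ?_ ?_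
  · rw [mem_Des_of_ne_zero T hi]
    exact asymm h
  · simp [sFilling, hi, SDT.swap]

/-- The two dominoes share a row. Standardness of `T` there fixes which one is on the left, and the
exchanged filling violates it. -/
theorem opBasis_of_not_isAbove {T : SDT μ n} {i : Fin n} (hi : i.val ≠ 0)
    (h : ¬IsAbove (T.dom (pred i)) (T.dom i)) (h' : ¬IsAbove (T.dom i) (T.dom (pred i))) :
    opBasis i T = 0 := by
  refine opBasis_of_forall_ne (by rwa [mem_Des_of_ne_zero T hi]) fun T' hT' => ?_
  simp only [sFilling, hi, if_false, Option.some.injEq] at hT'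
  obtain ⟨a, ha, b, hb, hab⟩ :=
    exists_row_eq_of_not_isAbove (T.isDomino (pred i)) (T.isDomino i) h h'
  have hlt := pred_lt hi
  rcases lt_trichotomy a.2 b.2 with hc | hc | hc
  · have ha' : a ∈ T'.dom i := by simpa [← hT'] using ha
    have hb' : b ∈ T'.dom (pred i) := by simpa [← hT'] using hb
    exact absurd (T'.row_le _ _ a ha' b hb' hab hc) (not_le.2 hlt)
  · obtain rfl : a = b := Prod.ext hab hc
    exact hlt.ne (T.eq_of_mem ha hb)
  · exact absurd (T.row_le _ _ b hb a ha hab.symm hc) (not_le.2 hlt)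

theorem op_single (i : Fin n) (T : SDT μ n) : op μ i (Finsupp.single T 1) = opBasis i T := by
  simp [op]

/-- The inclusion of tableaux into words of dominoes. -/
noncomputable def toWords (μ : YoungDiagram) (n : ℕ) :
    (SDT μ n →₀ ℂ) →ₗ[ℂ] ((Fin n → Finset (ℕ × ℕ)) →₀ ℂ) :=
  Finsupp.lmapDomain ℂ ℂ SDT.dom

theorem toWords_injective : Function.Injective (toWords μ n) :=
  Finsupp.mapDomain_injective SDT.dom_injective

theorem toWords_op {i : Fin n} (hi : i.val ≠ 0) (v : SDT μ n →₀ ℂ) :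
    toWords μ n (op μ i v) = sortOp IsAbove (pred i) i (toWords μ n v) := by
  suffices h : toWords μ n ∘ₗ op μ i = sortOp IsAbove (pred i) i ∘ₗ toWords μ n from
    LinearMap.congr_fun h v
  refine Finsupp.lhom_ext' fun T => LinearMap.ext_ring ?_
  change toWords μ n (op μ i (Finsupp.single T 1)) =
    sortOp IsAbove (pred i) i (toWords μ n (Finsupp.single T 1))
  have hs : ∀ T : SDT μ n, toWords μ n (Finsupp.single T 1) = Finsupp.single T.dom 1 := fun T => by
    simp [toWords, Finsupp.mapDomain_single]
  rw [op_single, hs]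
  by_cases h : IsAbove (T.dom (pred i)) (T.dom i)
  · rw [opBasis_of_mem ((mem_Des_of_ne_zero T hi).2 h), map_neg, hs, sortOp_of_rel h]
  by_cases h' : IsAbove (T.dom i) (T.dom (pred i))
  · rw [opBasis_of_isAbove hi h', hs, sortOp_of_rel_swap h']
    rfl
  · rw [opBasis_of_not_isAbove hi h h', sortOp_of_not_rel h h', map_zero]

theorem op_mul_self_of_ne_zero {i : Fin n} (hi : i.val ≠ 0) : op μ i * op μ i = -op μ i := by
  refine LinearMap.ext fun v => toWords_injective ?_
  simp only [Module.End.mul_apply, LinearMap.neg_apply, map_neg, toWords_op hi]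
  have h := LinearMap.congr_fun (sortOp_mul_self (r := IsAbove) (pred i) i) (toWords μ n v)
  simpa only [Module.End.mul_apply, LinearMap.neg_apply] using h

theorem op_mul_comm_of_ne_zero {i j : Fin n} (hi : i.val ≠ 0) (hij : i.val + 2 ≤ j.val) :
    op μ i * op μ j = op μ j * op μ i := by
  refine LinearMap.ext fun v => toWords_injective ?_
  have hj : j.val ≠ 0 := by omega
  have h1 := pred_val i
  have h2 := pred_val j
  simp only [Module.End.mul_apply, toWords_op hi, toWords_op hj]
  have h : sortOp IsAbove (pred i) i * sortOp IsAbove (pred j) j =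
      sortOp IsAbove (pred j) j * sortOp IsAbove (pred i) i := by
    apply sortOp_mul_comm <;> rw [Ne, Fin.ext_iff] <;> omega
  have h := LinearMap.congr_fun h (toWords μ n v)
  simpa only [Module.End.mul_apply] using h

theorem op_braid {i j : Fin n} (hi : 1 ≤ i.val) (hij : j.val = i.val + 1) :
    op μ i * op μ j * op μ i = op μ j * op μ i * op μ j := by
  refine LinearMap.ext fun v => toWords_injective ?_
  have hi : i.val ≠ 0 := by omega
  have hj : j.val ≠ 0 := by omega
  have h1 := pred_val i
  have h2 : pred j = i := Fin.ext (by rw [pred_val]; omega)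
  simp only [Module.End.mul_apply, toWords_op hi, toWords_op hj, h2]
  have h : sortOp IsAbove (pred i) i * sortOp IsAbove i j * sortOp IsAbove (pred i) i =
      sortOp IsAbove i j * sortOp IsAbove (pred i) i * sortOp IsAbove i j := by
    apply sortOp_braid <;> rw [Ne, Fin.ext_iff] <;> omega
  have h := LinearMap.congr_fun h (toWords μ n v)
  simpa only [Module.End.mul_apply] using h

end Tableaux

/-! ### The operator `π₀` -/

section Flip

variable {μ : YoungDiagram}

theorem reflect_row_zero : reflect {(0, 0), (0, 1)} = {(0, 0), (1, 0)} := by decide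

theorem reflect_row_one : reflect {(1, 0), (1, 1)} = {(0, 1), (1, 1)} := by decide

theorem eq_or_eq_of_val_le_one {z o k : Fin n} (hz : z.val = 0) (ho : o.val = 1)
    (hk : k.val ≤ 1) : k = z ∨ k = o := by
  rw [Fin.ext_iff, Fin.ext_iff]
  omega

/-- The entries `1` and `2` of `T` tile the northwest `2 × 2` square by horizontal dominoes. -/
structure IsFlippable (T : SDT μ n) (z o : Fin n) : Prop where
  val_zero : z.val = 0
  val_one : o.val = 1
  dom_zero : T.dom z = {(0, 0), (0, 1)}
  dom_one : T.dom o = {(1, 0), (1, 1)}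

/-- Reflecting the dominoes with entries `1` and `2`. -/
def flipDom (T : SDT μ n) (k : Fin n) : Finset (ℕ × ℕ) :=
  if k.val ≤ 1 then reflect (T.dom k) else T.dom k

variable {T : SDT μ n} {z o : Fin n}

theorem flipDom_of_one_lt {k : Fin n} (hk : 1 < k.val) : flipDom T k = T.dom k :=
  if_neg (not_le.2 hk)

theorem IsFlippable.flipDom_zero (H : IsFlippable T z o) : flipDom T z = {(0, 0), (1, 0)} := by
  rw [flipDom, if_pos (by simp [H.val_zero]), H.dom_zero, reflect_row_zero]

theorem IsFlippable.flipDom_one (H : IsFlippable T z o) : flipDom T o = {(0, 1), (1, 1)} := by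
  rw [flipDom, if_pos (by simp [H.val_one]), H.dom_one, reflect_row_one]

theorem IsFlippable.mem_of_mem_flipDom (H : IsFlippable T z o) {k : Fin n} {c : ℕ × ℕ}
    (hc : c ∈ flipDom T k) : ∃ l, c ∈ T.dom l ∧ (k.val ≤ 1 ∧ l.val ≤ 1 ∨ l = k) := by
  rcases Nat.lt_or_ge 1 k.val with hk | hk
  · rw [flipDom_of_one_lt hk] at hc
    exact ⟨k, hc, Or.inr rfl⟩
  have hz : z.val ≤ 1 := by simp [H.val_zero]
  have ho : o.val ≤ 1 := by simp [H.val_one]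
  suffices c ∈ T.dom z ∨ c ∈ T.dom o by
    rcases this with h | h
    · exact ⟨z, h, Or.inl ⟨hk, hz⟩⟩
    · exact ⟨o, h, Or.inl ⟨hk, ho⟩⟩
  rw [H.dom_zero, H.dom_one]
  rcases eq_or_eq_of_val_le_one H.val_zero H.val_one hk with rfl | rfl
  · rw [H.flipDom_zero] at hc
    simp only [Finset.mem_insert, Finset.mem_singleton] at hc ⊢
    tauto
  · rw [H.flipDom_one] at hc
    simp only [Finset.mem_insert, Finset.mem_singleton] at hc ⊢
    tauto

theorem IsFlippable.exists_mem_flipDom (H : IsFlippable T z o) {k : Fin n} {c : ℕ × ℕ}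
    (hc : c ∈ T.dom k) : ∃ l, c ∈ flipDom T l := by
  rcases Nat.lt_or_ge 1 k.val with hk | hk
  · exact ⟨k, by rwa [flipDom_of_one_lt hk]⟩
  suffices c ∈ flipDom T z ∨ c ∈ flipDom T o by
    rcases this with h | h
    exacts [⟨z, h⟩, ⟨o, h⟩]
  rw [H.flipDom_zero, H.flipDom_one]
  rcases eq_or_eq_of_val_le_one H.val_zero H.val_one hk with rfl | rfl
  · rw [H.dom_zero] at hc
    simp only [Finset.mem_insert, Finset.mem_singleton] at hc ⊢
    tauto
  · rw [H.dom_one] at hc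
    simp only [Finset.mem_insert, Finset.mem_singleton] at hc ⊢
    tauto

/-- After the flip the two dominoes are columns 0 and 1, so within this pair the entry order can be
read off the column index. -/
theorem IsFlippable.snd_eq (H : IsFlippable T z o) {k : Fin n} {c : ℕ × ℕ}
    (hk : k.val ≤ 1) (hc : c ∈ flipDom T k) : c.2 = k.val := by
  rcases eq_or_eq_of_val_le_one H.val_zero H.val_one hk with rfl | rfl
  · rw [H.flipDom_zero] at hc
    simp only [Finset.mem_insert, Finset.mem_singleton] at hc
    rcases hc with rfl | rfl <;> simp [H.val_zero]
  · rw [H.flipDom_one] at hc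
    simp only [Finset.mem_insert, Finset.mem_singleton] at hc
    rcases hc with rfl | rfl <;> simp [H.val_one]

/-- The tableau obtained by reflecting the dominoes with entries `1` and `2`. -/
def IsFlippable.flip (H : IsFlippable T z o) : SDT μ n where
  dom := flipDom T
  isDomino k := by
    rcases Nat.lt_or_ge 1 k.val with hk | hk
    · rw [flipDom_of_one_lt hk]
      exact T.isDomino k
    · rcases eq_or_eq_of_val_le_one H.val_zero H.val_one hk with rfl | rfl
      · exact Or.inr ⟨0, 0, H.flipDom_zero⟩
      · exact Or.inr ⟨0, 1, H.flipDom_one⟩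
  disjoint k l hkl := by
    rw [Finset.disjoint_left]
    intro c hk hl
    obtain ⟨k', hk', h1⟩ := H.mem_of_mem_flipDom hk
    obtain ⟨l', hl', h2⟩ := H.mem_of_mem_flipDom hl
    have e := congrArg Fin.val (T.eq_of_mem hk' hl')
    rw [Fin.ext_iff] at h1 h2
    refine hkl (Fin.ext ?_)
    by_cases hk1 : k.val ≤ 1 <;> by_cases hl1 : l.val ≤ 1
    · rw [← H.snd_eq hk1 hk, ← H.snd_eq hl1 hl]
    all_goals omega
  cover := by
    rw [← T.cover]
    ext c
    simp only [Finset.mem_biUnion, Finset.mem_univ, true_and]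
    constructor
    · rintro ⟨k, hk⟩
      obtain ⟨l, hl, -⟩ := H.mem_of_mem_flipDom hk
      exact ⟨l, hl⟩
    · rintro ⟨k, hk⟩
      exact H.exists_mem_flipDom hk
  row_le k l a ha b hb hr hc := by
    obtain ⟨k', hk', h1⟩ := H.mem_of_mem_flipDom ha
    obtain ⟨l', hl', h2⟩ := H.mem_of_mem_flipDom hb
    have e := T.row_le _ _ a hk' b hl' hr hc
    rw [Fin.ext_iff] at h1 h2
    rw [Fin.le_def] at e ⊢
    by_cases hk1 : k.val ≤ 1 <;> by_cases hl1 : l.val ≤ 1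
    · rw [← H.snd_eq hk1 ha, ← H.snd_eq hl1 hb]
      exact hc.le
    all_goals omega
  col_le k l a ha b hb hr hc := by
    obtain ⟨k', hk', h1⟩ := H.mem_of_mem_flipDom ha
    obtain ⟨l', hl', h2⟩ := H.mem_of_mem_flipDom hb
    have e := T.col_le _ _ a hk' b hl' hr hc
    rw [Fin.ext_iff] at h1 h2
    rw [Fin.le_def] at e ⊢
    by_cases hk1 : k.val ≤ 1 <;> by_cases hl1 : l.val ≤ 1
    · rw [← H.snd_eq hk1 ha, ← H.snd_eq hl1 hb]
      exact hr.le
    all_goals omega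

theorem row_zero_ne : ({(0, 0), (0, 1)} : Finset (ℕ × ℕ)) ≠ {(0, 0), (1, 0)} := by decide

theorem opBasis_of_vertical (hz : z.val = 0) (h : T.dom z = {(0, 0), (1, 0)}) :
    opBasis z T = -Finsupp.single T 1 :=
  opBasis_of_mem ((mem_Des_of_eq_zero T hz).2 h)

theorem IsFlippable.opBasis_eq (H : IsFlippable T z o) :
    opBasis z T = Finsupp.single H.flip 1 := by
  refine opBasis_of_eq_some ?_ ?_
  · rw [mem_Des_of_eq_zero T H.val_zero, H.dom_zero]
    exact row_zero_ne
  · have h1 : 1 < n := H.val_one ▸ o.2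
    have ho : (⟨1, h1⟩ : Fin n) = o := Fin.ext H.val_one.symm
    rw [sFilling, if_pos H.val_zero, dif_pos h1, ho, H.dom_zero, H.dom_one, if_pos (by decide)]
    rfl

theorem opBasis_of_not_isFlippable (hz : z.val = 0) (h : T.dom z = {(0, 0), (0, 1)})
    (hne : ∀ o, ¬IsFlippable T z o) : opBasis z T = 0 := by
  refine opBasis_of_forall_ne ?_ fun T' hT' => ?_
  · rw [mem_Des_of_eq_zero T hz, h]
    exact row_zero_ne
  · rw [sFilling, if_pos hz] at hT'
    split_ifs at hT' with h1 h2
    refine hne ⟨1, h1⟩ ⟨hz, rfl, h, ?_⟩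
    have hd : Disjoint (T.dom z) (T.dom ⟨1, h1⟩) := T.disjoint _ _ (by simp [Fin.ext_iff, hz])
    -- Once the first domino is the top row of the square, the second must be the remaining two
    -- cells.
    rw [← Finset.union_sdiff_cancel_left hd, h2, h]
    decide

/-! ### Relations involving `π₀`. -/

theorem op_zero_mul_self (hz : z.val = 0) : op μ z * op μ z = -op μ z := by
  refine Finsupp.lhom_ext' fun T => LinearMap.ext_ring ?_
  change op μ z (op μ z (Finsupp.single T 1)) = -op μ z (Finsupp.single T 1)
  rw [op_single]
  rcases T.dom_zero hz with h | h
  · by_cases hf : ∃ o, IsFlippable T z o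
    · obtain ⟨o, H⟩ := hf
      rw [H.opBasis_eq, op_single, opBasis_of_vertical hz H.flipDom_zero]
    · rw [opBasis_of_not_isFlippable hz h (not_exists.1 hf)]
      simp
  · rw [opBasis_of_vertical hz h, map_neg, op_single, opBasis_of_vertical hz h]

theorem pred_eq_zero (hz : z.val = 0) (ho : o.val = 1) : pred o = z :=
  Fin.ext (by rw [pred_val]; omega)

/-- The domino with entry 1 meets row 0, so the one with entry 2 is never strictly above it and `π₁`
never exchanges anything. -/
theorem exists_opBasis_one_eq_smul (hz : z.val = 0) (ho : o.val = 1) (T : SDT μ n) :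
    ∃ c : ℂ, op μ o (Finsupp.single T 1) = c • Finsupp.single T 1 := by
  have ho' : o.val ≠ 0 := by omega
  rw [op_single]
  by_cases h : IsAbove (T.dom (pred o)) (T.dom o)
  · exact ⟨-1, by rw [opBasis_of_mem ((mem_Des_of_ne_zero T ho').2 h), neg_one_smul]⟩
  · refine ⟨0, ?_⟩
    rw [opBasis_of_not_isAbove ho' h, zero_smul]
    rintro ⟨⟨a, ha⟩, -, h'⟩
    rw [pred_eq_zero hz ho] at h'
    exact absurd (h' a ha _ (T.origin_mem hz)) (by simp)

theorem IsFlippable.op_one_flip (H : IsFlippable T z o) :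
    op μ o (Finsupp.single H.flip 1) = 0 := by
  rw [op_single]
  have e0 : H.flip.dom z = {(0, 0), (1, 0)} := H.flipDom_zero
  have e1 : H.flip.dom o = {(0, 1), (1, 1)} := H.flipDom_one
  have ho := H.val_one
  apply opBasis_of_not_isAbove (by omega) <;>
    rw [pred_eq_zero H.val_zero H.val_one, e0, e1]
  · rintro ⟨-, -, h⟩
    exact absurd (h (0, 0) (by simp) (0, 1) (by simp)) (by simp)
  · rintro ⟨-, -, h⟩
    exact absurd (h (0, 1) (by simp) (0, 0) (by simp)) (by simp)

/-- Since `π₁` is diagonal, the only nontrivial case is a flippable tableau. Both sides vanish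
there, because `π₁` kills the flipped tableau. -/
theorem op_braidFour (hz : z.val = 0) (ho : o.val = 1) :
    op μ z * op μ o * op μ z * op μ o = op μ o * op μ z * op μ o * op μ z := by
  refine Finsupp.lhom_ext' fun T => LinearMap.ext_ring ?_
  change op μ z (op μ o (op μ z (op μ o (Finsupp.single T 1)))) =
    op μ o (op μ z (op μ o (op μ z (Finsupp.single T 1))))
  obtain ⟨c, hc⟩ := exists_opBasis_one_eq_smul hz ho T
  rcases T.dom_zero hz with h | h
  · by_cases hf : ∃ o, IsFlippable T z o
    · obtain ⟨o', H⟩ := hf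
      obtain rfl : o' = o := Fin.ext (H.val_one.trans ho.symm)
      have e := H.opBasis_eq
      rw [← op_single] at e
      simp only [hc, map_smul, e, H.op_one_flip, map_zero, smul_zero]
    · have e := opBasis_of_not_isFlippable hz h (not_exists.1 hf)
      rw [← op_single] at e
      simp only [hc, map_smul, e, map_zero, smul_zero]
  · have e := opBasis_of_vertical hz h
    rw [← op_single] at e
    simp only [hc, map_smul, e, map_neg, smul_neg]

theorem op_zero_mul_comm {j : Fin n} (hz : z.val = 0) (hj : 2 ≤ j.val) :
    op μ z * op μ j = op μ j * op μ z := by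
  refine Finsupp.lhom_ext' fun T => LinearMap.ext_ring ?_
  change op μ z (op μ j (Finsupp.single T 1)) = op μ j (op μ z (Finsupp.single T 1))
  have hj0 : j.val ≠ 0 := by omega
  have hp := pred_val j
  have hzp : z ≠ pred j := by rw [Ne, Fin.ext_iff]; omega
  have hzj : z ≠ j := by rw [Ne, Fin.ext_iff]; omega
  have hswap : ∀ (T : SDT μ n) (h : IsAbove (T.dom j) (T.dom (pred j))),
      (T.swap j hj0 h).dom z = T.dom z := fun T h => by
    simp [SDT.swap, Equiv.swap_apply_of_ne_of_ne hzp hzj]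
  have hswap' : ∀ (T : SDT μ n) (h : IsAbove (T.dom j) (T.dom (pred j))) (o : Fin n),
      o.val = 1 → (pred j).val ≠ 1 → (T.swap j hj0 h).dom o = T.dom o := fun T h o ho hp1 => by
    have h1 : o ≠ pred j := by rw [Ne, Fin.ext_iff]; omega
    have h2 : o ≠ j := by rw [Ne, Fin.ext_iff]; omega
    simp [SDT.swap, Equiv.swap_apply_of_ne_of_ne h1 h2]
  have hdesc : ∀ {T : SDT μ n}, IsAbove (T.dom (pred j)) (T.dom j) →
      opBasis j T = -Finsupp.single T 1 := fun {T} h =>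
    opBasis_of_mem ((mem_Des_of_ne_zero T hj0).2 h)
  rcases T.dom_zero hz with h | h
  · by_cases hf : ∃ o, IsFlippable T z o
    · obtain ⟨o, H⟩ := hf
      have ho := H.val_one
      have eo : H.flip.dom o = {(0, 1), (1, 1)} := H.flipDom_one
      have ej : H.flip.dom j = T.dom j := flipDom_of_one_lt (by omega)
      rw [op_single z, H.opBasis_eq, op_single, op_single]
      -- If `pred j = o`, then `π_j` compares entries 2 and 3, and the flip changes the domino with
      -- entry 2. Otherwise the two operators act on disjoint pairs of dominoes.
      by_cases hpo : pred j = o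
      · by_cases h1 : IsAbove (T.dom (pred j)) (T.dom j)
        · have h1' : IsAbove (H.flip.dom (pred j)) (H.flip.dom j) := by
            refine ⟨H.flip.nonempty_dom _, H.flip.nonempty_dom _, fun a ha b hb => ?_⟩
            rw [ej] at hb
            have h3 := h1.2.2 (1, 0) (by simp [hpo, H.dom_one]) b hb
            rw [hpo, eo] at ha
            simp only [Finset.mem_insert, Finset.mem_singleton] at ha
            rcases ha with rfl | rfl <;> simp only at h3 ⊢ <;> omega
          rw [hdesc h1, hdesc h1', map_neg, op_single, H.opBasis_eq]
        by_cases h2 : IsAbove (T.dom j) (T.dom (pred j))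
        -- Entry 3 lies in row 0. Exchanging first destroys the square, and flipping first makes
        -- entries 2 and 3 share row 0, so both composites vanish.
        · have hrow : ∀ b ∈ T.dom j, b.1 = 0 := fun b hb => by
            have := h2.2.2 b hb (1, 0) (by simp [hpo, H.dom_one])
            simp only at this
            omega
          obtain ⟨b, hb⟩ := T.nonempty_dom j
          rw [opBasis_of_isAbove hj0 h2, op_single]
          have hdo : (T.swap j hj0 h2).dom o = T.dom j := by simp [SDT.swap, ← hpo]
          rw [opBasis_of_not_isFlippable hz ((hswap T h2).trans h), opBasis_of_not_isAbove hj0]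
          · rintro ⟨-, -, h3⟩
            have := h3 (1, 1) (by simp [hpo, eo]) b (by rwa [ej])
            simp [hrow b hb] at this
          · rintro ⟨-, -, h3⟩
            have := h3 b (by rwa [ej]) (0, 1) (by simp [hpo, eo])
            simp at this
          · intro o' H'
            obtain rfl : o' = o := Fin.ext (H'.val_one.trans ho.symm)
            have := H'.dom_one
            rw [hdo] at this
            have := hrow (1, 0) (by simp [this])
            simp at this
        · obtain ⟨a, ha, b, hb, hab⟩ :=
            exists_row_eq_of_not_isAbove (T.isDomino (pred j)) (T.isDomino j) h1 h2
          have ha1 : a.1 = 1 := by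
            rw [hpo, H.dom_one] at ha
            simp only [Finset.mem_insert, Finset.mem_singleton] at ha
            rcases ha with rfl | rfl <;> rfl
          rw [opBasis_of_not_isAbove hj0 h1 h2, map_zero, opBasis_of_not_isAbove hj0]
          · rintro ⟨-, -, h3⟩
            have := h3 (1, 1) (by simp [hpo, eo]) b (by rwa [ej])
            simp only at this
            omega
          · rintro ⟨-, -, h3⟩
            have := h3 b (by rwa [ej]) (1, 1) (by simp [hpo, eo])
            simp only at this
            omega
      · have hp1 : (pred j).val ≠ 1 := fun e => hpo (Fin.ext (e.trans ho.symm))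
        have ep : H.flip.dom (pred j) = T.dom (pred j) := flipDom_of_one_lt (by omega)
        by_cases h1 : IsAbove (T.dom (pred j)) (T.dom j)
        · rw [hdesc h1, hdesc (by rwa [ej, ep]), map_neg, op_single, H.opBasis_eq]
        by_cases h2 : IsAbove (T.dom j) (T.dom (pred j))
        · have h2' : IsAbove (H.flip.dom j) (H.flip.dom (pred j)) := by rwa [ej, ep]
          have H' : IsFlippable (T.swap j hj0 h2) z o :=
            ⟨hz, ho, (hswap T h2).trans h, (hswap' T h2 o ho hp1).trans H.dom_one⟩
          rw [opBasis_of_isAbove hj0 h2, opBasis_of_isAbove hj0 h2', op_single, H'.opBasis_eq]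
          congr 1
          refine SDT.dom_injective (funext fun k => ?_)
          change flipDom (T.swap j hj0 h2) k = flipDom T (Equiv.swap (pred j) j k)
          rcases Nat.lt_or_ge 1 k.val with hk | hk
          · rw [flipDom_of_one_lt hk, flipDom_of_one_lt]
            · rfl
            · rw [Equiv.swap_apply_def]
              split_ifs <;> omega
          · have k1 : k ≠ pred j := by rw [Ne, Fin.ext_iff]; omega
            have k2 : k ≠ j := by rw [Ne, Fin.ext_iff]; omega
            simp [flipDom, SDT.swap, Equiv.swap_apply_of_ne_of_ne k1 k2]
        · rw [opBasis_of_not_isAbove hj0 h1 h2, map_zero,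
            opBasis_of_not_isAbove hj0 (by rwa [ej, ep]) (by rwa [ej, ep])]
    · have e : op μ z (Finsupp.single T 1) = 0 := by
        rw [op_single, opBasis_of_not_isFlippable hz h (not_exists.1 hf)]
      rw [e, map_zero, op_single]
      by_cases h1 : IsAbove (T.dom (pred j)) (T.dom j)
      · rw [hdesc h1, map_neg, e, neg_zero]
      by_cases h2 : IsAbove (T.dom j) (T.dom (pred j))
      · rw [opBasis_of_isAbove hj0 h2, op_single]
        refine opBasis_of_not_isFlippable hz ((hswap T h2).trans h) fun o H => ?_
        have ho := H.val_one
        -- An exchange could create the flippable square only by bringing entry 3 into row 1 while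
        -- entry 2 lies below it. But then the row 1 cell above entry 2 would have to be covered by
        -- entry 1 or 2, and neither meets row 1.
        by_cases hp1 : (pred j).val = 1
        · obtain rfl : pred j = o := Fin.ext (hp1.trans ho.symm)
          have hdj : T.dom j = {(1, 0), (1, 1)} := by
            rw [← H.dom_one]
            simp [SDT.swap]
          obtain ⟨b, hb⟩ := T.nonempty_dom (pred j)
          have hb1 := h2.2.2 (1, 0) (by simp [hdj]) b hb
          obtain ⟨k, hk, hmem⟩ := T.exists_mem_of_le hb
            (show ((1, b.2) : ℕ × ℕ) ≤ b from ⟨hb1.le, le_rfl⟩)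
          have hk : k.val ≤ (pred j).val := hk
          rcases eq_or_eq_of_val_le_one hz ho (hk.trans_eq hp1) with rfl | rfl
          · simp [h] at hmem
          · exact lt_irrefl _ (h2.2.2 (1, 0) (by simp [hdj]) (1, b.2) hmem)
        · exact hf ⟨o, hz, ho, h, (hswap' T h2 o ho hp1).symm.trans H.dom_one⟩
      · rw [opBasis_of_not_isAbove hj0 h1 h2, map_zero]
  · rw [op_single z, opBasis_of_vertical hz h, op_single, map_neg, op_single]
    by_cases h1 : IsAbove (T.dom (pred j)) (T.dom j)
    · rw [hdesc h1, map_neg, op_single, opBasis_of_vertical hz h]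
    by_cases h2 : IsAbove (T.dom j) (T.dom (pred j))
    · rw [opBasis_of_isAbove hj0 h2, op_single, opBasis_of_vertical hz ((hswap T h2).trans h)]
    · rw [opBasis_of_not_isAbove hj0 h1 h2, map_zero, neg_zero]

/-! ### The module of standard domino tableaux -/

/-- The representation of `H_n^B(0)` on `ℂ SDT(μ)` given by the operators `π_i`. -/
noncomputable def dominoRep (μ : YoungDiagram) (n : ℕ) :
    HeckeB n →ₐ[ℂ] Module.End ℂ (SDT μ n →₀ ℂ) :=
  RingQuot.liftAlgHom ℂ ⟨FreeAlgebra.lift ℂ (fun i => op μ i), by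
    intro x y h
    cases h with
    | sq i =>
      simp only [map_mul, map_neg, FreeAlgebra.lift_ι_apply]
      by_cases hi : i.val = 0
      · exact op_zero_mul_self hi
      · exact op_mul_self_of_ne_zero hi
    | comm i j h =>
      simp only [map_mul, FreeAlgebra.lift_ι_apply]
      by_cases hi : i.val = 0
      · exact op_zero_mul_comm hi (by omega)
      · exact op_mul_comm_of_ne_zero hi h
    | braid i j hi hj =>
      simp only [map_mul, FreeAlgebra.lift_ι_apply]
      exact op_braid hi hj
    | braidFour i j hi hj =>
      simp only [map_mul, FreeAlgebra.lift_ι_apply]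
      exact op_braidFour hi hj⟩

theorem dominoRep_gen (i : Fin n) : dominoRep μ n (gen i) = op μ i := by
  simp [dominoRep, gen]

/-! ### Triangularity -/

open Classical in
/-- A statistic on tableaux that the exchanges `s_i` increase outside descents. -/
noncomputable def height (T : SDT μ n) : ℕ :=
  ∑ k : Fin n, ((if IsVertical (T.dom k) then 1 else 0) + k.val * (T.dom k).sup Prod.fst)

theorem sum_lt_sum_of_two {κ : Type*} [Fintype κ] [DecidableEq κ] {f g : κ → ℕ} {p q : κ}
    (hpq : p ≠ q) (h : ∀ k, k ≠ p → k ≠ q → f k = g k) (hlt : f p + f q < g p + g q) :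
    ∑ k, f k < ∑ k, g k := by
  have hq : q ∈ Finset.univ.erase p := by simp [hpq.symm]
  rw [← Finset.add_sum_erase _ f (Finset.mem_univ p), ← Finset.add_sum_erase _ g
    (Finset.mem_univ p), ← Finset.add_sum_erase _ f hq, ← Finset.add_sum_erase _ g hq]
  have : ∑ k ∈ (Finset.univ.erase p).erase q, f k = ∑ k ∈ (Finset.univ.erase p).erase q, g k :=
    Finset.sum_congr rfl fun k hk => by
      simp only [Finset.mem_erase] at hk
      exact h k hk.2.1 hk.1
  omega

theorem IsAbove.sup_lt {d e : Finset (ℕ × ℕ)} (h : IsAbove d e) :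
    d.sup Prod.fst < e.sup Prod.fst := by
  obtain ⟨⟨a, ha⟩, ⟨b, hb⟩, h⟩ := h
  have hb' : b.1 ≤ e.sup Prod.fst := Finset.le_sup (f := Prod.fst) hb
  have hpos : ⊥ < e.sup Prod.fst := lt_of_lt_of_le (Nat.zero_le a.1 |>.trans_lt (h a ha b hb)) hb'
  exact (Finset.sup_lt_iff hpos).2 fun a ha => (h a ha b hb).trans_le hb'

/-- The exchange gives the larger weight to the lower domino, so the weighted sum of bottom rows
grows by the difference of the two bottom rows. -/
theorem height_lt_swap (T : SDT μ n) {i : Fin n} (hi : i.val ≠ 0)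
    (h : IsAbove (T.dom i) (T.dom (pred i))) : height T < height (T.swap i hi h) := by
  refine sum_lt_sum_of_two (pred_ne hi) (fun k h1 h2 => ?_) ?_
  · have : (T.swap i hi h).dom k = T.dom k := by
      simp [SDT.swap, Equiv.swap_apply_of_ne_of_ne h1 h2]
    rw [this]
  · have hlt := h.sup_lt
    obtain ⟨m, hm⟩ := Nat.exists_eq_succ_of_ne_zero hi
    have e1 : (T.swap i hi h).dom (pred i) = T.dom i := by simp [SDT.swap]
    have e2 : (T.swap i hi h).dom i = T.dom (pred i) := by simp [SDT.swap]
    rw [e1, e2]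
    simp only [pred_val, hm, Nat.succ_eq_add_one, Nat.add_sub_cancel, add_mul, one_mul]
    omega

theorem IsFlippable.height_lt_flip (H : IsFlippable T z o) : height T < height H.flip := by
  have hz := H.val_zero
  have ho := H.val_one
  refine sum_lt_sum_of_two (p := z) (q := o) (by rw [Ne, Fin.ext_iff]; omega)
    (fun k h1 h2 => ?_) ?_
  · have : H.flip.dom k = T.dom k := flipDom_of_one_lt <| by
      rw [Ne, Fin.ext_iff] at h1 h2
      omega
    rw [this]
  · have e0 : H.flip.dom z = {(0, 0), (1, 0)} := H.flipDom_zero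
    have e1 : H.flip.dom o = {(0, 1), (1, 1)} := H.flipDom_one
    have v0 : IsVertical {(0, 0), (1, 0)} := ⟨0, 0, rfl⟩
    have v1 : IsVertical {(0, 1), (1, 1)} := ⟨0, 1, rfl⟩
    rw [hz, ho, e0, e1, if_pos v0, if_pos v1, H.dom_zero, H.dom_one]
    have u0 : ¬IsVertical {(0, 0), (0, 1)} := fun h =>
      row_zero_ne ((isVertical_iff_of_mem_zero (Or.inl rfl)).1 h)
    rw [if_neg u0]
    -- The row terms agree before and after: index 0 has weight 0, and the second domino reaches row
    -- 1 in both tableaux. The count of vertical dominoes alone decides, being 2 after the flip and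
    -- at most 1 before it.
    simp only [Finset.sup_insert, Finset.sup_singleton, zero_mul, one_mul, Nat.max_def]
    split_ifs <;> simp_all

theorem isTriangular_dominoRep (μ : YoungDiagram) (n : ℕ) :
    IsTriangular (dominoRep μ n) Des height := by
  intro i T
  rw [dominoRep_gen, op_single]
  have hdesc : i ∈ Des T → ∃ w ∈ Finsupp.supported ℂ ℂ {T' | height T < height T'},
      opBasis i T = (if i ∈ Des T then (-1 : ℂ) else 0) • Finsupp.single T 1 + w := fun h =>
    ⟨0, zero_mem _, by rw [opBasis_of_mem h, if_pos h, neg_one_smul, add_zero]⟩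
  have hzero : i ∉ Des T → opBasis i T = 0 →
      ∃ w ∈ Finsupp.supported ℂ ℂ {T' | height T < height T'},
        opBasis i T = (if i ∈ Des T then (-1 : ℂ) else 0) • Finsupp.single T 1 + w := fun h h' =>
    ⟨0, zero_mem _, by rw [h', if_neg h, zero_smul, add_zero]⟩
  have hasc : ∀ T', i ∉ Des T → opBasis i T = Finsupp.single T' 1 → height T < height T' →
      ∃ w ∈ Finsupp.supported ℂ ℂ {T' | height T < height T'},
        opBasis i T = (if i ∈ Des T then (-1 : ℂ) else 0) • Finsupp.single T 1 + w :=
    fun T' h h' hlt => ⟨Finsupp.single T' 1, Finsupp.single_mem_supported ℂ 1 hlt, by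
      rw [h', if_neg h, zero_smul, zero_add]⟩
  by_cases hD : i ∈ Des T
  · exact hdesc hD
  by_cases hi : i.val = 0
  · have h : T.dom i = {(0, 0), (0, 1)} := (T.dom_zero hi).resolve_right
      fun h => hD ((mem_Des_of_eq_zero T hi).2 h)
    by_cases hf : ∃ o, IsFlippable T i o
    · obtain ⟨o, H⟩ := hf
      exact hasc _ hD H.opBasis_eq H.height_lt_flip
    · exact hzero hD (opBasis_of_not_isFlippable hi h (not_exists.1 hf))
  · by_cases h : IsAbove (T.dom i) (T.dom (pred i))
    · exact hasc _ hD (opBasis_of_isAbove hi h) (height_lt_swap T hi h)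
    · exact hzero hD (opBasis_of_not_isAbove hi
        (fun h' => hD ((mem_Des_of_ne_zero T hi).2 h')) h)

end Flip

end DominoHecke

theorem mainTheorem8 (n : ℕ) (μ : YoungDiagram) (hμ : μ.card = 2 * n) :
    (∃ ch : DominoHecke.G0 n →+ DominoHecke.QSymB, DominoHecke.IsCharB ch) ∧
    ∃ ρ : DominoHecke.HeckeB n →ₐ[ℂ] Module.End ℂ (DominoHecke.SDT μ n →₀ ℂ),
      (∀ i : Fin n, ρ (DominoHecke.gen i) = DominoHecke.op μ i) ∧
      ∀ ch : DominoHecke.G0 n →+ DominoHecke.QSymB, DominoHecke.IsCharB ch →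
        (ch (DominoHecke.G0.cls n (DominoHecke.RepModule ρ)) : MvPowerSeries ℕ ℂ) =
          DominoHecke.dominoFunction μ n := by
  refine ⟨⟨_, DominoHecke.isCharB_characteristic n⟩, DominoHecke.dominoRep μ n,
    DominoHecke.dominoRep_gen, fun ch hch => ?_⟩
  have h : ∀ T : DominoHecke.SDT μ n, (ch (DominoHecke.G0.cls n
      (DominoHecke.SimpleB (DominoHecke.Des T))) : MvPowerSeries ℕ ℂ) =
        DominoHecke.FB (DominoHecke.Des T) := fun T => hch _
  rw [(DominoHecke.isTriangular_dominoRep μ n).cls_repModule, map_sum, Submodule.coe_sum]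
  simp only [h, DominoHecke.dominoFunction]
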